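/- Let $\mathcal Y$ be a finite set, let $X$ take values in a measurable space $\mathcal X$ with law $P_X$, let $p(\cdot\mid x)=P_{Y|X=x}$ be a Markov kernel from $\mathcal X$ to $\mathcal Y$, let $P_Z$ be a Borel probability measure on $\mathbb R^d$ (for example a standard Gaussian), and let $\beta>0$. For a conditional distribution $r(y\mid z)$, i.e. a Markov kernel from $\mathbb R^d$ to $\mathcal Y$, put $$G(r)=-E_{X\sim P_X}\Big[\log E_{Z\sim P_Z}\Big[e^{\beta\sum_{y\in\mathcal Y}p(y\mid X)\log r(y\mid Z)}\Big]\Big]\in[0,\infty]$$ (with $\log 0=-\infty$, $0\cdot(-\infty)=0$, $e^{-\infty}=0$), and let $G=\inf_r G(r)$ be the optimal value of the MA-IB problem. Fix a continuous activation function $\sigma:\mathbb R\to\mathbb R$ that is not affine. For a parameter $\theta$ (weights and biases) of a multilayer perceptron with activation $\sigma$, some fixed number ($\ge 1$) and widths of hidden layers, input in $\mathbb R^d$ and output in $\mathbb R^{\mathcal Y}$, let $r_\theta(y\mid z)$ be the output of the perceptron at $z$ followed by a softmax layer. Let $x_1,x_2,\dots$ be i.i.d. from $P_X$; given $x_i$,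 let $y_{1,i},y_{2,i},\dots$ be i.i.d. from $P_{Y|X=x_i}$, the blocks $(x_i,(y_{k,i})_{k\ge1})$ being independent for different $i$; and let $z_1,z_2,\dots$ be i.i.d. from $P_Z$. For $n,m,l\ge1$ define $$F(\theta)=-\frac1n\sum_{i=1}^n\log\Big(\frac1m\sum_{j=1}^m e^{-\beta\kappa_{ij}(\theta)}\Big),\qquad \kappa_{ij}(\theta)=-\frac1l\sum_{k=1}^l\log r_\theta(y_{k,i}\mid z_j).$$ Theorem 2 (strong consistency of the neural MA-IB estimator). $G$ is finite, and for every $\varepsilon>0$ there exist an architecture (number and widths of hidden layers) and a nonempty compact set $\Theta$ of its parameters, depending only on $P_X$, $P_{Y|X}$, $P_Z$, $\beta$, $\sigma$ and $\varepsilon$, such that the empirical optimum $\widehat G_{mnl}=\inf_{\theta\in\Theta}F(\theta)$ satisfies the following with probability one: there exist integers $M,N,L$ (which may depend on the realization of the samples) such that $$|G-\widehat G_{mnl}|<\varepsilon\qquad\text{for all } n>N,\ m>M,\ l>L.$$ -/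

import Mathlib

open MeasureTheory ProbabilityTheory Filter
open scoped ENNReal Matrix

noncomputable section

namespace MAIB

universe u v w

/-! ### The MA-IB problem -/

section Functional

variable {X : Type u} [MeasurableSpace X] {Y : Type v} [Fintype Y] [MeasurableSpace Y]
  {Z : Type w} [MeasurableSpace Z]

/-- The exponent `β E_{Y ∼ P_{Y|X=x}} [log r(Y|z)]`, where the label set is finite, densities on it
are taken with respect to the counting measure and `log 0 = -∞`, `0 * (-∞) = 0`. -/
def exponent (PYX : Kernel X Y) (β : ℝ) (r : Kernel Z Y) (x : X) (z : Z) : EReal :=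
  (β : EReal) * ∑ y, ((PYX x {y} : ℝ≥0∞) : EReal) * ENNReal.log (r z {y})

/-- The functional `G(r) = - E_{P_X} [log (E_{P_Z} [exp (β E_{P_{Y|X}} [log r(Y|Z)])])]`.
For `β ≥ 0` and a Markov kernel `r` the inner expectation is at most `1`, so the integrand
`- log (...)` takes values in `[0, ∞]` and the integral over `x` is a Lebesgue integral there. -/
def objective (PX : Measure X) (PYX : Kernel X Y) (PZ : Measure Z) (β : ℝ) (r : Kernel Z Y) :
    ℝ≥0∞ :=
  ∫⁻ x, (-ENNReal.log (∫⁻ z, EReal.exp (exponent PYX β r x z) ∂PZ)).toENNReal ∂PX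

/-- The optimal value of the MA-IB problem: the infimum of `G(r)` over all conditional
distributions `r(y|z)` from `Z` to `Y`. -/
def optimalValue (PX : Measure X) (PYX : Kernel X Y) (PZ : Measure Z) (β : ℝ) : ℝ≥0∞ :=
  ⨅ (r : Kernel Z Y) (_ : IsMarkovKernel r), objective PX PYX PZ β r

end Functional

/-! ### Multilayer perceptrons followed by a softmax layer -/

/-- The parameters (weight matrices and bias vectors) of a fully connected network with `a` inputs,
hidden layers of the listed widths, and one output (logit) for every element of `Y`. -/
def Params (Y : Type v) : ℕ → List ℕ → Type v
  | a, [] => Matrix Y (Fin a) ℝ × (Y → ℝ)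
  | a, b :: hidden => (Matrix (Fin b) (Fin a) ℝ × (Fin b → ℝ)) × Params Y b hidden

/-- The usual (product) topology on the parameter space. -/
instance Params.topology (Y : Type v) : (a : ℕ) → (hidden : List ℕ) →
    TopologicalSpace (Params Y a hidden)
  | a, [] => inferInstanceAs (TopologicalSpace (Matrix Y (Fin a) ℝ × (Y → ℝ)))
  | a, b :: hidden =>
    @instTopologicalSpaceProd (Matrix (Fin b) (Fin a) ℝ × (Fin b → ℝ)) (Params Y b hidden)
      inferInstance (Params.topology Y b hidden)

/-- The multilayer perceptron with activation function `σ`: every hidden layer is an affine map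
followed by a componentwise application of `σ`; the last layer is affine. -/
def mlp {Y : Type v} (σ : ℝ → ℝ) :
    (a : ℕ) → (hidden : List ℕ) → Params Y a hidden → (Fin a → ℝ) → Y → ℝ
  | _, [], θ, x => θ.1 *ᵥ x + θ.2
  | _, b :: hidden, θ, x => mlp σ b hidden θ.2 (fun i => σ ((θ.1.1 *ᵥ x + θ.1.2) i))

/-- The softmax of a vector of logits. -/
def softmax {Y : Type v} [Fintype Y] (v : Y → ℝ) (y : Y) : ℝ :=
  Real.exp (v y) / ∑ y', Real.exp (v y')

/-- The network `r_θ(y|z)`. -/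
def net {Y : Type v} [Fintype Y] (σ : ℝ → ℝ) {d : ℕ} {hidden : List ℕ} (θ : Params Y d hidden)
    (z : Fin d → ℝ) (y : Y) : ℝ :=
  softmax (mlp σ d hidden θ z) y

/-! ### The Monte-Carlo loss -/

section Loss

variable {Y : Type v} [Fintype Y] {d : ℕ} {hidden : List ℕ}

/-- `κ_{ij}(θ) = - (1/l) ∑_{k<l} log r_θ(y_{k,i} | z_j)`, for the labels `ys = (y_{k,i})_k` of one
sample `x_i` and one sample `z = z_j`. -/
def kappa (σ : ℝ → ℝ) (θ : Params Y d hidden) (l : ℕ) (ys : ℕ → Y) (z : Fin d → ℝ) : ℝ :=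
  -((1 / (l : ℝ)) * ∑ k ∈ Finset.range l, Real.log (net σ θ z (ys k)))

/-- `F(θ) = - (1/n) ∑_{i<n} log ((1/m) ∑_{j<m} exp (- β κ_{ij}(θ)))`. -/
def loss (β : ℝ) (σ : ℝ → ℝ) (n m l : ℕ) (ys : ℕ → ℕ → Y) (zs : ℕ → Fin d → ℝ)
    (θ : Params Y d hidden) : ℝ :=
  -((1 / (n : ℝ)) * ∑ i ∈ Finset.range n,
    Real.log ((1 / (m : ℝ)) * ∑ j ∈ Finset.range m, Real.exp (-β * kappa σ θ l (ys i) (zs j))))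

/-- `Ĝ_{mnl} = inf_{θ ∈ Θ} F(θ)`. -/
def estimator (β : ℝ) (σ : ℝ → ℝ) (Θ : Set (Params Y d hidden)) (n m l : ℕ)
    (ys : ℕ → ℕ → Y) (zs : ℕ → Fin d → ℝ) : ℝ :=
  sInf (loss β σ n m l ys zs '' Θ)

end Loss

/-! ### The samples -/

/-- `xs i` are i.i.d. from `P_X`; given `xs i = x`, the labels `ys i k` (`k = 0, 1, ...`) are i.i.d.
from `P_{Y|X=x}`; the blocks `(xs i, (ys i k)_k)` are independent for different `i`; and `zs j` are
i.i.d. from `P_Z`. -/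
structure IsSample {X : Type u} [MeasurableSpace X] {Y : Type v} [MeasurableSpace Y] {d : ℕ}
    (PX : Measure X) (PYX : Kernel X Y) (PZ : Measure (Fin d → ℝ))
    {Ω : Type w} [MeasurableSpace Ω] (μ : Measure Ω)
    (xs : ℕ → Ω → X) (ys : ℕ → ℕ → Ω → Y) (zs : ℕ → Ω → Fin d → ℝ) : Prop where
  measurable_xs : ∀ i, Measurable (xs i)
  measurable_ys : ∀ i k, Measurable (ys i k)
  measurable_zs : ∀ j, Measurable (zs j)
  /-- The joint law of `xs i` and its first `l` labels (the case `l = 0` says `xs i ∼ P_X`). -/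
  law_block : ∀ (i l : ℕ) (A : Set X) (B : ℕ → Set Y), MeasurableSet A →
    (∀ k, MeasurableSet (B k)) →
      μ {ω | xs i ω ∈ A ∧ ∀ k < l, ys i k ω ∈ B k} =
        ∫⁻ x in A, ∏ k ∈ Finset.range l, PYX x (B k) ∂PX
  indep_block : iIndepFun (fun i ω => (xs i ω, fun k => ys i k ω)) μ
  law_zs : ∀ j, μ.map (zs j) = PZ
  indep_zs : iIndepFun zs μ

end MAIB

end

open MAIB

/-! Write `freeEnergy` for the inner expression - log E_Z exp(β ∑ p(y) s(Z, y)), where s is a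
log-likelihood; G(r) is its average over x at p = p(·|x). The proof separates approximation from
estimation.

Approximation. A nearly optimal r is mixed with the uniform distribution, so that its log-likelihood
is bounded, at a small cost in G (`lintegral_freeEnergy_le_objective_add`). A bounded measurable s
is close to a continuous function on a compact set of large mass, hence to the logits of a network;
the small exceptional set hardly changes the expectation, which is bounded below
(`exists_net_freeEnergy_le`). Universal approximation comes from Stone-Weierstrass: a closed space
containing all σ ∘ (a f + b) with σ not affine contains f² (`mul_self_mem_of_comp_mem`), so limits
of networks of arbitrary depth form an algebra.

Estimation. The loss depends on the labels of x_i only through their empirical frequencies, a point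
of the compact simplex. The partition functions are averages of random elements of a Banach space
C(simplex × Θ), so the strong law in sup norm is uniform in labels and parameters at once. A second
strong law over the blocks, together with control of the blocks whose frequencies have not settled,
gives convergence uniform in θ ∈ Θ (`IsSample.ae_loss_near`).

The infimum over Θ is nearly at least G because each network is an admissible r, and nearly at most
G because Θ contains a nearly optimal network. -/

namespace MAIB

open Topology

/-! ### Smoothing a continuous function by moving integrals -/

section Smoothing

/-- The moving integral `t ↦ ∫ s in 0..h, ψ (t + s)`. -/
noncomputable def movingIntegral (ψ : C(ℝ, ℝ)) (h : ℝ) : C(ℝ, ℝ) where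
  toFun t := ∫ s in (0 : ℝ)..h, ψ (t + s)
  continuous_toFun :=
    intervalIntegral.continuous_parametric_intervalIntegral_of_continuous' (by fun_prop) 0 h

theorem movingIntegral_apply (ψ : C(ℝ, ℝ)) (h t : ℝ) :
    movingIntegral ψ h t = ∫ s in (0 : ℝ)..h, ψ (t + s) := rfl

/-- Each moving integral gains a derivative and turns it into a difference, so applying it twice to
σ yields a function whose second derivative is a second difference of σ. -/
theorem hasDerivAt_movingIntegral (ψ : C(ℝ, ℝ)) (h t : ℝ) :
    HasDerivAt (movingIntegral ψ h) (ψ (t + h) - ψ t) t := by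
  have hP : ∀ t, HasDerivAt (fun u => ∫ s in (0 : ℝ)..u, ψ s) (ψ t) t := fun t =>
    (ψ.continuous.integral_hasStrictDerivAt 0 t).hasDerivAt
  have key : ∀ t, movingIntegral ψ h t
      = (∫ s in (0 : ℝ)..(t + h), ψ s) - ∫ s in (0 : ℝ)..t, ψ s := by
    intro t
    rw [movingIntegral_apply, intervalIntegral.integral_comp_add_left (fun s => ψ s) t, add_zero,
      intervalIntegral.integral_interval_sub_left] <;> exact ψ.continuous.intervalIntegrable _ _
  have h1 : HasDerivAt (fun t => (∫ s in (0 : ℝ)..(t + h), ψ s) - ∫ s in (0 : ℝ)..t, ψ s)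
      (ψ (t + h) - ψ t) t :=
    (HasDerivAt.comp_add_const t h (hP (t + h))).sub (hP t)
  exact h1.congr_of_eventuallyEq (Eventually.of_forall key)

/-- A continuous function all of whose second differences vanish is affine. -/
theorem exists_affine_of_second_difference_eq_zero {σ : ℝ → ℝ} (hσ : Continuous σ)
    (h0 : ∀ t h, σ (t + h + h) - σ (t + h) - (σ (t + h) - σ t) = 0) :
    ∃ a b : ℝ, ∀ t, σ t = a * t + b := by
  let τ : ℝ →+ ℝ := AddMonoidHom.mk' (fun t => σ t - σ 0) (by
    intro x y
    -- The pairs (x, y) and (0, x + y) have the same midpoint, so comparing their second differences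
    -- gives additivity of σ - σ 0.
    have h1 := h0 x ((y - x) / 2)
    have h2 := h0 0 ((x + y) / 2)
    have e1 : x + (y - x) / 2 + (y - x) / 2 = y := by ring
    have e2 : x + (y - x) / 2 = 0 + (x + y) / 2 := by ring
    have e3 : 0 + (x + y) / 2 + (x + y) / 2 = x + y := by ring
    rw [e1, e2] at h1
    rw [e3] at h2
    linarith)
  have hτ : Continuous τ := by
    change Continuous (fun t => σ t - σ 0)
    fun_prop
  refine ⟨τ 1, σ 0, fun t => ?_⟩
  have h1 : τ.toRealLinearMap hτ (t • (1 : ℝ)) = t • τ.toRealLinearMap hτ 1 :=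
    map_smul _ _ _
  have h2 : τ t = t * τ 1 := by simpa using h1
  have h3 : τ t = σ t - σ 0 := rfl
  linarith

/-- Second order Taylor expansion for the symmetric second difference. -/
theorem eventually_abs_symm_second_difference_le {g g' : ℝ → ℝ} {t c : ℝ}
    (hg : ∀ s, HasDerivAt g (g' s) s) (hg' : HasDerivAt g' c t) {ε : ℝ} (hε : 0 < ε) :
    ∃ δ > 0, ∀ s, |s| < δ → |g (t + s) + g (t - s) - 2 * g t - c * s ^ 2| ≤ ε * s ^ 2 := by
  have h1 := hasDerivAt_iff_isLittleO.1 hg'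
  have h2 := h1.def (half_pos hε)
  obtain ⟨δ, hδ, h3⟩ := Metric.eventually_nhds_iff.1 h2
  refine ⟨δ, hδ, fun s hs => ?_⟩
  -- The remainder vanishes at step 0, and its derivative is a difference of two first-order errors
  -- of `g'` at t, each at most ε/2 * |u|. The mean value inequality then suffices; `g'` need only
  -- be differentiable at t.
  have hd : ∀ u, HasDerivAt (fun u => g (t + u) + g (t - u) - 2 * g t - c * u ^ 2)
      (g' (t + u) - g' (t - u) - 2 * c * u) u := by
    intro u
    have a1 : HasDerivAt (fun u => g (t + u)) (g' (t + u)) u :=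
      HasDerivAt.comp_const_add t u (hg _)
    have a2 : HasDerivAt (fun u => g (t - u)) (-g' (t - u)) u :=
      HasDerivAt.comp_const_sub t u (hg _)
    have a3 : HasDerivAt (fun u : ℝ => c * u ^ 2) (c * (2 * u)) u := by
      simpa using (hasDerivAt_pow 2 u).const_mul c
    exact (((a1.add a2).sub_const (2 * g t)).sub a3).congr_deriv (by ring)
  have hb : ∀ u ∈ Set.uIcc 0 s, ‖g' (t + u) - g' (t - u) - 2 * c * u‖ ≤ ε * |s| := by
    intro u hu
    have hus : |u| ≤ |s| := by
      have := Set.abs_sub_left_of_mem_uIcc hu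
      simpa using this
    have b1 := h3 (y := t + u) (by simpa [Real.dist_eq] using hus.trans_lt hs)
    have b2 := h3 (y := t - u) (by simpa [Real.dist_eq] using hus.trans_lt hs)
    simp only [add_sub_cancel_left, smul_eq_mul, Real.norm_eq_abs, sub_sub_cancel_left,
      abs_neg] at b1 b2
    rw [Real.norm_eq_abs]
    have : g' (t + u) - g' (t - u) - 2 * c * u
        = (g' (t + u) - g' t - u * c) - (g' (t - u) - g' t - -u * c) := by ring
    rw [this]
    refine (abs_sub _ _).trans ?_
    nlinarith [abs_nonneg u]
  have := (convex_uIcc 0 s).norm_image_sub_le_of_norm_hasDerivWithin_le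
    (fun u _ => (hd u).hasDerivWithinAt) hb Set.left_mem_uIcc Set.right_mem_uIcc
  have e0 : g (t + 0) + g (t - 0) - 2 * g t - c * 0 ^ 2 = 0 := by simp; ring
  rw [e0] at this
  simp only [sub_zero, Real.norm_eq_abs] at this
  calc _ ≤ ε * |s| * |s| := this
    _ = ε * s ^ 2 := by rw [mul_assoc, abs_mul_abs_self, sq]

end Smoothing

/-! ### Squares from a non-affine activation. -/

section ClosedSubmodule

variable {K : Type*} [TopologicalSpace K] [CompactSpace K]

/-- The composition is a Bochner integral in C(K) of the functions ψ ∘ (f + s), and averages of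
members of a closed convex set stay in it. -/
theorem movingIntegral_comp_mem {B : Submodule ℝ C(K, ℝ)} (hB : IsClosed (B : Set C(K, ℝ)))
    (ψ : C(ℝ, ℝ)) (h : ℝ) (f : C(K, ℝ))
    (hf : ∀ s : ℝ, ψ.comp (f + ContinuousMap.const K s) ∈ B) :
    (movingIntegral ψ h).comp f ∈ B := by
  have hc : Continuous fun s : ℝ => ψ.comp (f + ContinuousMap.const K s) := by
    refine (ContinuousMap.continuous_postcomp ψ).comp (continuous_const.add ?_)
    exact ContinuousMap.continuous_const'
  have e : (movingIntegral ψ h).comp f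
      = ∫ s in (0 : ℝ)..h, ψ.comp (f + ContinuousMap.const K s) := by
    ext x
    have := (ContinuousMap.evalCLM ℝ x).intervalIntegral_comp_comm
      (hc.intervalIntegrable (μ := volume) 0 h)
    simp only [ContinuousMap.evalCLM_apply] at this
    rw [← this]
    rfl
  rw [e]
  have hmem : ∀ a b : ℝ, ∫ s in Set.Ioc a b, ψ.comp (f + ContinuousMap.const K s) ∈ B := by
    intro a b
    by_cases hab : volume (Set.Ioc a b) = 0
    · rw [Measure.restrict_eq_zero.2 hab, integral_zero_measure]
      exact B.zero_mem
    · have h1 := B.convex.set_average_mem hB hab (by simp)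
        (f := fun s => ψ.comp (f + ContinuousMap.const K s)) (μ := volume)
        (Eventually.of_forall hf) (hc.integrableOn_Ioc)
      have h2 := B.smul_mem (volume.real (Set.Ioc a b)) h1
      rwa [measure_smul_setAverage _ (by simp)] at h2
  rw [intervalIntegral]
  exact B.sub_mem (hmem _ _) (hmem _ _)

/-- A closed space of continuous functions that contains all `σ ∘ (a f + b)`, where `σ` is
continuous and not affine, contains `f ^ 2`. -/
theorem mul_self_mem_of_comp_mem {B : Submodule ℝ C(K, ℝ)} (hB : IsClosed (B : Set C(K, ℝ)))
    {σ : C(ℝ, ℝ)} (hσ : ¬ ∃ a b : ℝ, ∀ t, σ t = a * t + b) (f : C(K, ℝ))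
    (hf : ∀ a b : ℝ, σ.comp (a • f + ContinuousMap.const K b) ∈ B) : f * f ∈ B := by
  obtain ⟨t, h, hth⟩ : ∃ t h, σ (t + h + h) - σ (t + h) - (σ (t + h) - σ t) ≠ 0 := by
    by_contra! hcon
    exact hσ (exists_affine_of_second_difference_eq_zero σ.continuous hcon)
  set c := σ (t + h + h) - σ (t + h) - (σ (t + h) - σ t) with hc
  -- This `g` is twice differentiable with second derivative c ≠ 0 at t, although σ is only
  -- continuous.
  set g := movingIntegral (movingIntegral σ h) h with hgdef
  have hgB : ∀ a b : ℝ, g.comp (a • f + ContinuousMap.const K b) ∈ B := by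
    intro a b
    refine movingIntegral_comp_mem hB _ _ _ fun s => movingIntegral_comp_mem hB _ _ _ fun s' => ?_
    have := hf a (b + s + s')
    convert this using 2
    ext x
    simp only [ContinuousMap.add_apply, ContinuousMap.const_apply]
    ring
  have hg := hasDerivAt_movingIntegral (movingIntegral σ h) h
  have hg' : HasDerivAt (fun s => movingIntegral σ h (s + h) - movingIntegral σ h s) c t :=
    (HasDerivAt.comp_add_const t h (hasDerivAt_movingIntegral σ h (t + h))).sub
      (hasDerivAt_movingIntegral σ h t)
  suffices hs : c • (f * f) ∈ B by
    have := B.smul_mem c⁻¹ hs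
    rwa [smul_smul, inv_mul_cancel₀ hth, one_smul] at this
  rw [← SetLike.mem_coe, ← hB.closure_eq, Metric.mem_closure_iff]
  intro ε hε
  set C := ‖f‖ + 1 with hC
  have hCpos : 0 < C := by positivity
  obtain ⟨δ, hδ, hδ'⟩ := eventually_abs_symm_second_difference_le hg hg'
    (ε := ε / (2 * C ^ 2)) (by positivity)
  -- Since |f| ≤ C, every step a f(x) stays below δ.
  set a := δ / (2 * C) with ha
  have hapos : 0 < a := by positivity
  -- The symmetric second difference of `g` at t with step a f(x), divided by a², is uniformly close
  -- to c f(x)².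
  refine ⟨(a ^ 2)⁻¹ • (g.comp (a • f + ContinuousMap.const K t)
    + g.comp ((-a) • f + ContinuousMap.const K t)
    - (2 : ℝ) • g.comp ((0 : ℝ) • f + ContinuousMap.const K t)), ?_, ?_⟩
  · exact B.smul_mem _ (B.sub_mem (B.add_mem (hgB _ _) (hgB _ _)) (B.smul_mem _ (hgB _ _)))
  · refine lt_of_le_of_lt ((ContinuousMap.dist_le (half_pos hε).le).2 fun x => ?_) (half_lt_self hε)
    have hfx : |f x| ≤ C := by
      have := f.norm_coe_le_norm x
      rw [Real.norm_eq_abs] at this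
      linarith
    have hax : |a * f x| < δ := by
      rw [abs_mul, abs_of_pos hapos]
      calc a * |f x| ≤ a * C := by gcongr
        _ = δ / 2 := by rw [ha]; field_simp
        _ < δ := half_lt_self hδ
    have h1 := hδ' _ hax
    simp only [ContinuousMap.smul_apply, ContinuousMap.mul_apply, ContinuousMap.sub_apply,
      ContinuousMap.add_apply, ContinuousMap.comp_apply, ContinuousMap.const_apply, smul_eq_mul]
    rw [Real.dist_eq, abs_sub_comm]
    have e : (a ^ 2)⁻¹ * (g (a * f x + t) + g (-a * f x + t) - 2 * g (0 * f x + t))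
        - c * (f x * f x) = (a ^ 2)⁻¹ * (g (t + a * f x) + g (t - a * f x) - 2 * g t
          - c * (a * f x) ^ 2) := by
      rw [show a * f x + t = t + a * f x by ring, show -a * f x + t = t - a * f x by ring,
        show 0 * f x + t = t by ring]
      field_simp
    rw [e, abs_mul, abs_of_pos (by positivity)]
    calc (a ^ 2)⁻¹ * _ ≤ (a ^ 2)⁻¹ * (ε / (2 * C ^ 2) * (a * f x) ^ 2) := by gcongr
      _ = ε / (2 * C ^ 2) * |f x| ^ 2 := by rw [sq_abs]; field_simp
      _ ≤ ε / (2 * C ^ 2) * C ^ 2 := by gcongr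
      _ = ε / 2 := by field_simp

end ClosedSubmodule

/-! ### Spaces of functions computed by networks -/

section NetworkSpan

variable {K : Type*} [TopologicalSpace K] {d : ℕ}

/-- The span of the constants and of the outputs of the neurons in layer `k` of networks with
inputs `c`; the neurons in layer `0` are the inputs. -/
noncomputable def networkSpan (σ : C(ℝ, ℝ)) (c : Fin d → C(K, ℝ)) : ℕ → Submodule ℝ C(K, ℝ)
  | 0 => Submodule.span ℝ (insert 1 (Set.range c))
  | k + 1 => Submodule.span ℝ
      (insert 1 ((fun f : C(K, ℝ) => σ.comp f) '' (networkSpan σ c k : Set C(K, ℝ))))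

theorem one_mem_networkSpan (σ : C(ℝ, ℝ)) (c : Fin d → C(K, ℝ)) (k : ℕ) :
    (1 : C(K, ℝ)) ∈ networkSpan σ c k := by
  cases k <;> exact Submodule.subset_span (Set.mem_insert _ _)

variable [CompactSpace K]

theorem comp_mem_closure_networkSpan {σ : C(ℝ, ℝ)} {c : Fin d → C(K, ℝ)} {k : ℕ} {f : C(K, ℝ)}
    (hf : f ∈ (networkSpan σ c k).topologicalClosure) :
    σ.comp f ∈ (networkSpan σ c (k + 1)).topologicalClosure := by
  refine map_mem_closure (ContinuousMap.continuous_postcomp σ) hf fun g hg => ?_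
  exact Submodule.subset_span (Set.mem_insert_of_mem _ ⟨g, hg, rfl⟩)

theorem const_mem_closure_networkSpan (σ : C(ℝ, ℝ)) (c : Fin d → C(K, ℝ)) (k : ℕ) (b : ℝ) :
    ContinuousMap.const K b ∈ (networkSpan σ c k).topologicalClosure := by
  refine Submodule.le_topologicalClosure _ ?_
  have := (networkSpan σ c k).smul_mem b (one_mem_networkSpan σ c k)
  convert this using 1
  ext x
  simp

theorem mul_self_mem_closure_networkSpan {σ : C(ℝ, ℝ)} (hσ : ¬ ∃ a b : ℝ, ∀ t, σ t = a * t + b)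
    {c : Fin d → C(K, ℝ)} {k : ℕ} {f : C(K, ℝ)}
    (hf : f ∈ (networkSpan σ c k).topologicalClosure) :
    f * f ∈ (networkSpan σ c (k + 1)).topologicalClosure :=
  mul_self_mem_of_comp_mem (Submodule.isClosed_topologicalClosure _) hσ f fun a b =>
    comp_mem_closure_networkSpan
      (Submodule.add_mem _ (Submodule.smul_mem _ a hf) (const_mem_closure_networkSpan σ c k b))

/-- The outputs of one layer are not directly available in the next; they are recovered from squares
by 4f = (f + 1)² - (f - 1)². -/
theorem closure_networkSpan_le_succ {σ : C(ℝ, ℝ)} (hσ : ¬ ∃ a b : ℝ, ∀ t, σ t = a * t + b)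
    (c : Fin d → C(K, ℝ)) (k : ℕ) :
    (networkSpan σ c k).topologicalClosure ≤ (networkSpan σ c (k + 1)).topologicalClosure := by
  intro f hf
  have h1 := mul_self_mem_closure_networkSpan hσ
    (Submodule.add_mem _ hf (const_mem_closure_networkSpan σ c k 1))
  have h2 := mul_self_mem_closure_networkSpan hσ
    (Submodule.sub_mem _ hf (const_mem_closure_networkSpan σ c k 1))
  have h3 := Submodule.smul_mem _ (1 / 4 : ℝ) (Submodule.sub_mem _ h1 h2)
  convert h3 using 1
  ext x
  simp only [ContinuousMap.smul_apply, ContinuousMap.sub_apply, ContinuousMap.mul_apply,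
    ContinuousMap.add_apply, ContinuousMap.const_apply, smul_eq_mul]
  ring

theorem monotone_closure_networkSpan {σ : C(ℝ, ℝ)} (hσ : ¬ ∃ a b : ℝ, ∀ t, σ t = a * t + b)
    (c : Fin d → C(K, ℝ)) : Monotone fun k => (networkSpan σ c k).topologicalClosure :=
  monotone_nat_of_le_succ (closure_networkSpan_le_succ hσ c)

theorem mul_mem_closure_networkSpan {σ : C(ℝ, ℝ)} (hσ : ¬ ∃ a b : ℝ, ∀ t, σ t = a * t + b)
    {c : Fin d → C(K, ℝ)} {k : ℕ} {f g : C(K, ℝ)}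
    (hf : f ∈ (networkSpan σ c k).topologicalClosure)
    (hg : g ∈ (networkSpan σ c k).topologicalClosure) :
    f * g ∈ (networkSpan σ c (k + 1)).topologicalClosure := by
  have h1 := mul_self_mem_closure_networkSpan hσ (Submodule.add_mem _ hf hg)
  have h2 := mul_self_mem_closure_networkSpan hσ (Submodule.sub_mem _ hf hg)
  have h3 := Submodule.smul_mem _ (1 / 4 : ℝ) (Submodule.sub_mem _ h1 h2)
  convert h3 using 1
  ext x
  simp only [ContinuousMap.smul_apply, ContinuousMap.sub_apply, ContinuousMap.mul_apply,
    ContinuousMap.add_apply, smul_eq_mul]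
  ring

/-- The functions that are uniform limits of networks of some fixed depth. -/
noncomputable def networkAlgebra (σ : C(ℝ, ℝ)) (hσ : ¬ ∃ a b : ℝ, ∀ t, σ t = a * t + b)
    (c : Fin d → C(K, ℝ)) : Subalgebra ℝ C(K, ℝ) where
  carrier := {f | ∃ k, f ∈ (networkSpan σ c k).topologicalClosure}
  mul_mem' := by
    rintro f g ⟨k, hf⟩ ⟨l, hg⟩
    exact ⟨max k l + 1, mul_mem_closure_networkSpan hσ
      (monotone_closure_networkSpan hσ c (le_max_left k l) hf)
      (monotone_closure_networkSpan hσ c (le_max_right k l) hg)⟩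
  add_mem' := by
    rintro f g ⟨k, hf⟩ ⟨l, hg⟩
    exact ⟨max k l, Submodule.add_mem _
      (monotone_closure_networkSpan hσ c (le_max_left k l) hf)
      (monotone_closure_networkSpan hσ c (le_max_right k l) hg)⟩
  algebraMap_mem' b := ⟨0, const_mem_closure_networkSpan σ c 0 b⟩

/-- Finitely many continuous functions are uniformly approximated by networks of one depth. -/
theorem exists_networkSpan_near {σ : C(ℝ, ℝ)} (hσ : ¬ ∃ a b : ℝ, ∀ t, σ t = a * t + b)
    {c : Fin d → C(K, ℝ)} (hc : ∀ x y, x ≠ y → ∃ i, c i x ≠ c i y)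
    {Y : Type*} [Finite Y] (f : Y → C(K, ℝ)) {ε : ℝ} (hε : 0 < ε) :
    ∃ k, ∃ g : Y → C(K, ℝ), ∀ y, g y ∈ networkSpan σ c (k + 1) ∧ ∀ x, |f y x - g y x| < ε := by
  have htop : (networkAlgebra σ hσ c).topologicalClosure = ⊤ := by
    refine ContinuousMap.subalgebra_topologicalClosure_eq_top_of_separatesPoints _ ?_
    intro x y hxy
    obtain ⟨i, hi⟩ := hc x y hxy
    refine ⟨c i, ⟨c i, ⟨0, Submodule.le_topologicalClosure _ ?_⟩, rfl⟩, hi⟩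
    exact Submodule.subset_span (Set.mem_insert_of_mem _ ⟨i, rfl⟩)
  have h1 : ∀ y, ∃ k, ∃ g ∈ (networkSpan σ c k).topologicalClosure, dist (f y) g < ε / 2 := by
    intro y
    have : f y ∈ closure (networkAlgebra σ hσ c : Set C(K, ℝ)) := by
      have : f y ∈ (networkAlgebra σ hσ c).topologicalClosure := by rw [htop]; trivial
      exact this
    obtain ⟨g, ⟨k, hk⟩, hg⟩ := Metric.mem_closure_iff.1 this (ε / 2) (half_pos hε)
    exact ⟨k, g, hk, hg⟩
  choose k g hg hfg using h1
  -- Finitely many depths have a common bound; using k0 + 1 ensures at least one hidden layer.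
  obtain ⟨k0, hk0⟩ := Set.Finite.bddAbove (Set.finite_range k)
  have h2 : ∀ y, ∃ g' ∈ networkSpan σ c (k0 + 1), dist (g y) g' < ε / 2 := fun y =>
    Metric.mem_closure_iff.1 (monotone_closure_networkSpan hσ c
      ((hk0 ⟨y, rfl⟩).trans (Nat.le_succ k0)) (hg y)) (ε / 2) (half_pos hε)
  choose g' hg' hgg' using h2
  refine ⟨k0, g', fun y => ⟨hg' y, fun x => ?_⟩⟩
  rw [← Real.dist_eq]
  calc dist (f y x) (g' y x) ≤ dist (f y) (g' y) := ContinuousMap.dist_apply_le_dist x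
    _ ≤ dist (f y) (g y) + dist (g y) (g' y) := dist_triangle _ _ _
    _ < ε := by linarith [hfg y, hgg' y]

end NetworkSpan

/-! ### Realization by multilayer perceptrons -/

section Realization

variable {Y : Type*} {K : Type*} [TopologicalSpace K] {d : ℕ}

theorem exists_mlp_eq_comp_affine (σ : ℝ → ℝ) {p q : ℕ} (A : Matrix (Fin p) (Fin q) ℝ)
    (b : Fin p → ℝ) (hidden : List ℕ) (θ : Params Y p hidden) :
    ∃ θ' : Params Y q hidden, ∀ x, mlp σ q hidden θ' x = mlp σ p hidden θ (A *ᵥ x + b) := by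
  cases hidden with
  | nil =>
    refine ⟨(θ.1 * A, θ.1 *ᵥ b + θ.2), fun x => ?_⟩
    simp only [mlp, Matrix.mulVec_add, Matrix.mulVec_mulVec, add_assoc]
  | cons w hidden =>
    refine ⟨((θ.1.1 * A, θ.1.1 *ᵥ b + θ.1.2), θ.2), fun x => ?_⟩
    simp only [mlp, Matrix.mulVec_add, Matrix.mulVec_mulVec, add_assoc]

/-- Finitely many elements of the span use finitely many generators, which are pooled so that all
elements become affine images of one vector: a single layer. -/
theorem exists_eq_mulVec_of_mem_span_insert {ι : Type*} [Finite ι] {s : Set C(K, ℝ)}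
    {g : ι → C(K, ℝ)} (hg : ∀ i, g i ∈ Submodule.span ℝ (insert 1 s)) :
    ∃ (q : ℕ) (e : Fin q → C(K, ℝ)) (A : Matrix ι (Fin q) ℝ) (b : ι → ℝ), (∀ j, e j ∈ s) ∧
      ∀ x, (fun i => g i x) = A *ᵥ (fun j => e j x) + b := by
  simp_rw [Submodule.mem_span_insert] at hg
  choose b z hz hgz using hg
  have h1 := fun i => Submodule.mem_span_finite_of_mem_span (hz i)
  choose T hTs hT using h1
  classical
  have := Fintype.ofFinite ι
  set U : Finset C(K, ℝ) := Finset.univ.biUnion T with hU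
  have h2 : ∀ i, z i ∈ Submodule.span ℝ (U : Set C(K, ℝ)) := fun i =>
    Submodule.span_mono (by exact_mod_cast Finset.subset_biUnion_of_mem T (Finset.mem_univ i)) (hT i)
  simp_rw [Submodule.mem_span_finset] at h2
  choose a ha1 ha using h2
  refine ⟨U.card, fun j => (U.equivFin.symm j : C(K, ℝ)),
    Matrix.of fun i j => a i (U.equivFin.symm j), b, fun j => ?_, fun x => ?_⟩
  · obtain ⟨i, -, hi⟩ := Finset.mem_biUnion.1 (U.equivFin.symm j).2
    exact hTs i hi
  · ext i
    have h3 : ∑ j, a i (U.equivFin.symm j) * (U.equivFin.symm j : C(K, ℝ)) x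
        = ∑ u ∈ U, a i u * u x := by
      rw [Equiv.sum_comp U.equivFin.symm (fun u : U => a i u * (u : C(K, ℝ)) x)]
      exact Finset.sum_coe_sort U (fun u => a i u * u x)
    simp only [Pi.add_apply, Matrix.mulVec, dotProduct, Matrix.of_apply]
    rw [h3, hgz i, ← ha i]
    simp [ContinuousMap.sum_apply, add_comm]

/-- The network is built from the output backwards. The affine map producing g is merged into the
first layer of θ, and a hidden layer with identity weights is prepended to apply σ; its inputs lie
one level lower. -/
theorem exists_mlp_eq_comp_networkSpan (σ : C(ℝ, ℝ)) (c : Fin d → C(K, ℝ)) (k : ℕ) :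
    ∀ {p : ℕ} {g : Fin p → C(K, ℝ)}, (∀ i, g i ∈ networkSpan σ c k) →
      ∀ (hidden : List ℕ) (θ : Params Y p hidden),
        ∃ (hidden' : List ℕ) (θ' : Params Y d hidden'), (hidden ≠ [] → hidden' ≠ []) ∧
          ∀ x, mlp σ d hidden' θ' (fun i => c i x) = mlp σ p hidden θ (fun i => g i x) := by
  induction k with
  | zero =>
    intro p g hg hidden θ
    obtain ⟨q, e, A, b, he, h⟩ := exists_eq_mulVec_of_mem_span_insert hg
    choose idx hidx using he
    obtain ⟨θ₁, h₁⟩ := exists_mlp_eq_comp_affine σ A b hidden θ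
    obtain ⟨θ₂, h₂⟩ := exists_mlp_eq_comp_affine σ
      (Matrix.of fun j i => if idx j = i then (1 : ℝ) else 0) 0 hidden θ₁
    refine ⟨hidden, θ₂, id, fun x => ?_⟩
    rw [h x, ← h₁, h₂]
    congr 1
    ext j
    simp [Matrix.mulVec, dotProduct, ← hidx j]
  | succ k ih =>
    intro p g hg hidden θ
    obtain ⟨q, e, A, b, he, h⟩ := exists_eq_mulVec_of_mem_span_insert hg
    choose f hf hfe using he
    obtain ⟨θ₁, h₁⟩ := exists_mlp_eq_comp_affine σ A b hidden θ
    obtain ⟨hidden', θ', hne, h₂⟩ := ih hf (q :: hidden) ((1, 0), θ₁)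
    refine ⟨hidden', θ', fun _ => hne (List.cons_ne_nil _ _), fun x => ?_⟩
    rw [h x, ← h₁, h₂]
    simp only [mlp, Matrix.one_mulVec, add_zero]
    congr 1
    ext j
    rw [← hfe j]
    rfl

theorem exists_mlp_eq_of_mem_networkSpan [Finite Y] (σ : C(ℝ, ℝ)) (c : Fin d → C(K, ℝ)) {k : ℕ}
    {g : Y → C(K, ℝ)} (hg : ∀ y, g y ∈ networkSpan σ c (k + 1)) :
    ∃ (hidden : List ℕ) (θ : Params Y d hidden), hidden ≠ [] ∧
      ∀ x y, mlp σ d hidden θ (fun i => c i x) y = g y x := by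
  obtain ⟨q, e, A, b, he, h⟩ := exists_eq_mulVec_of_mem_span_insert hg
  choose f hf hfe using he
  obtain ⟨hidden, θ, hne, h₂⟩ := exists_mlp_eq_comp_networkSpan (Y := Y) σ c k hf [q] ((1, 0), (A, b))
  refine ⟨hidden, θ, hne (List.cons_ne_nil _ _), fun x y => ?_⟩
  rw [h₂]
  simp only [mlp, Matrix.one_mulVec, add_zero]
  rw [show g y x = (fun y => g y x) y from rfl, h x]
  refine congrArg (fun v => (A *ᵥ v + b) y) (funext fun j => ?_)
  rw [← hfe j]
  rfl

end Realization

/-- Universal approximation by deep networks: for a continuous activation function that is not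
affine, multilayer perceptrons approximate finitely many continuous functions uniformly on
compact sets. -/
theorem exists_mlp_near {Y : Type*} [Finite Y] {d : ℕ} {σ : ℝ → ℝ} (hσ : Continuous σ)
    (hσ' : ¬ ∃ a b : ℝ, ∀ t, σ t = a * t + b) {K : Set (Fin d → ℝ)} (hK : IsCompact K)
    {u : Y → (Fin d → ℝ) → ℝ} (hu : ∀ y, Continuous (u y)) {ε : ℝ} (hε : 0 < ε) :
    ∃ (hidden : List ℕ) (θ : Params Y d hidden), hidden ≠ [] ∧
      ∀ z ∈ K, ∀ y, |u y z - mlp σ d hidden θ z y| < ε := by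
  have := isCompact_iff_compactSpace.1 hK
  let c : Fin d → C(K, ℝ) := fun i => ⟨fun z => z.1 i, (continuous_apply i).comp continuous_subtype_val⟩
  obtain ⟨k, g, hg⟩ := exists_networkSpan_near (σ := ⟨σ, hσ⟩) hσ' (c := c)
    (fun x y hxy => by
      by_contra! h
      exact hxy (Subtype.ext (funext h)))
    (fun y => ⟨fun z : K => u y z, by have := hu y; fun_prop⟩) hε
  obtain ⟨hidden, θ, hne, h⟩ := exists_mlp_eq_of_mem_networkSpan ⟨σ, hσ⟩ c fun y => (hg y).1
  refine ⟨hidden, θ, hne, fun z hz y => ?_⟩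
  have h1 := (hg y).2 ⟨z, hz⟩
  rw [← h ⟨z, hz⟩ y] at h1
  exact h1

/-! ### Laws of large numbers -/

section StrongLaw

/-- Strong law of large numbers for a bounded function of i.i.d. variables. -/
theorem ae_tendsto_average_comp {Ω : Type*} [MeasurableSpace Ω] {μ : Measure Ω}
    {S : Type*} [MeasurableSpace S] {E : Type*} [NormedAddCommGroup E] [NormedSpace ℝ E]
    [CompleteSpace E] {W : ℕ → Ω → S} (hW : ∀ i, Measurable (W i)) (hind : iIndepFun W μ)
    {ν : Measure S} [IsFiniteMeasure ν] (hlaw : ∀ i, μ.map (W i) = ν)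
    {f : S → E} (hf : StronglyMeasurable f) {C : ℝ} (hC : ∀ s, ‖f s‖ ≤ C) :
    ∀ᵐ ω ∂μ, Tendsto (fun n : ℕ => (n : ℝ)⁻¹ • ∑ i ∈ Finset.range n, f (W i ω)) atTop
      (𝓝 (∫ s, f s ∂ν)) := by
  borelize E
  have hint : Integrable f ν := Integrable.of_bound hf.aestronglyMeasurable C
    (Eventually.of_forall hC)
  have h0 := strong_law_ae (μ := μ) (fun i ω => f (W i ω)) ?_ ?_ ?_
  · have e : ∫ ω, f (W 0 ω) ∂μ = ∫ s, f s ∂ν := by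
      rw [← hlaw 0, integral_map (hW 0).aemeasurable hf.aestronglyMeasurable]
    rwa [e] at h0
  · rw [← hlaw 0] at hint
    exact hint.comp_measurable (hW 0)
  · intro i j hij
    exact (hind.indepFun hij).comp hf.measurable hf.measurable
  · intro i
    have : IdentDistrib (W i) (W 0) μ μ :=
      ⟨(hW i).aemeasurable, (hW 0).aemeasurable, by rw [hlaw, hlaw]⟩
    exact this.comp hf.measurable

end StrongLaw

/-! ### The law of a block of samples -/

section Labels

variable {X : Type*} [MeasurableSpace X] {Y : Type*} [MeasurableSpace Y]

/-- The law of an i.i.d. sequence of labels of `x`. -/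
noncomputable def labelSequenceKernel (PYX : Kernel X Y) [IsMarkovKernel PYX] :
    Kernel X (ℕ → Y) where
  toFun x := Measure.infinitePi fun _ : ℕ => PYX x
  measurable' := by
    refine Measurable.measure_of_isPiSystem_of_isProbabilityMeasure
      generateFrom_squareCylinders.symm
      (isPiSystem_squareCylinders (fun _ => MeasurableSpace.isPiSystem_measurableSet)
        fun _ => MeasurableSet.univ) ?_
    rintro _ ⟨s, t, ht, rfl⟩
    have ht' : ∀ i, MeasurableSet (t i) := fun i => ht i trivial
    simp_rw [Measure.infinitePi_pi (fun _ : ℕ => PYX _) (s := s) (t := t) fun i _ => ht' i]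
    exact Finset.measurable_prod _ fun i _ => Kernel.measurable_coe _ (ht' i)

theorem labelSequenceKernel_apply (PYX : Kernel X Y) [IsMarkovKernel PYX] (x : X) :
    labelSequenceKernel PYX x = Measure.infinitePi fun _ : ℕ => PYX x := rfl

instance (PYX : Kernel X Y) [IsMarkovKernel PYX] : IsMarkovKernel (labelSequenceKernel PYX) :=
  ⟨fun x => by rw [labelSequenceKernel_apply]; infer_instance⟩

theorem IsSample.measurable_block {d : ℕ} {PX : Measure X} {PYX : Kernel X Y}
    {PZ : Measure (Fin d → ℝ)} {Ω : Type*} [MeasurableSpace Ω] {μ : Measure Ω}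
    {xs : ℕ → Ω → X} {ys : ℕ → ℕ → Ω → Y} {zs : ℕ → Ω → Fin d → ℝ}
    (h : IsSample PX PYX PZ μ xs ys zs) (i : ℕ) :
    Measurable fun ω => (xs i ω, fun k => ys i k ω) :=
  (h.measurable_xs i).prodMk (measurable_pi_lambda _ fun k => h.measurable_ys i k)

theorem IsSample.map_block {d : ℕ} {PX : Measure X} [IsProbabilityMeasure PX] {PYX : Kernel X Y}
    [IsMarkovKernel PYX] {PZ : Measure (Fin d → ℝ)} {Ω : Type*} [MeasurableSpace Ω] {μ : Measure Ω}
    [IsProbabilityMeasure μ] {xs : ℕ → Ω → X} {ys : ℕ → ℕ → Ω → Y} {zs : ℕ → Ω → Fin d → ℝ}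
    (h : IsSample PX PYX PZ μ xs ys zs) (i : ℕ) :
    μ.map (fun ω => (xs i ω, fun k => ys i k ω)) = PX ⊗ₘ labelSequenceKernel PYX := by
  have hm := h.measurable_block i
  have := Measure.isProbabilityMeasure_map (μ := μ) hm.aemeasurable
  refine ext_of_generate_finite _ (generateFrom_eq_prod MeasurableSpace.generateFrom_measurableSet
    generateFrom_squareCylinders isCountablySpanning_measurableSet ?_).symm
    (MeasurableSpace.isPiSystem_measurableSet.prod
      (isPiSystem_squareCylinders (fun _ => MeasurableSpace.isPiSystem_measurableSet)
        fun _ => MeasurableSet.univ)) ?_ (by simp)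
  · exact ⟨fun _ => Set.univ, fun _ => ⟨∅, fun _ => Set.univ, by simp, by simp⟩,
      Set.iUnion_const _⟩
  · rintro _ ⟨A, hA, _, ⟨s, t, ht, rfl⟩, rfl⟩
    have ht' : ∀ k, MeasurableSet (t k) := fun k => ht k trivial
    have hs : MeasurableSet ((s : Set ℕ).pi t) :=
      MeasurableSet.pi s.countable_toSet fun k _ => ht' k
    classical
    -- `law_block` speaks of initial segments of labels, so a cylinder over s is padded with the
    -- whole space up to the largest index in s.
    let B : ℕ → Set Y := fun k => if k ∈ s then t k else Set.univ
    have hB : ∀ k, MeasurableSet (B k) := fun k => by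
      by_cases hk : k ∈ s <;> simp [B, hk, ht']
    have hl := h.law_block i (s.sup id + 1) A B hA hB
    have hsub : s ⊆ Finset.range (s.sup id + 1) := fun k hk =>
      Finset.mem_range_succ_iff.2 (Finset.le_sup (f := id) hk)
    change MeasurableSet A at hA
    rw [Measure.map_apply hm (hA.prod hs), Measure.compProd_apply_prod hA hs]
    have e1 : (fun ω => (xs i ω, fun k => ys i k ω)) ⁻¹' (A ×ˢ (s : Set ℕ).pi t)
        = {ω | xs i ω ∈ A ∧ ∀ k < s.sup id + 1, ys i k ω ∈ B k} := by
      ext ω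
      simp only [Set.mem_preimage, Set.mem_prod, Set.mem_pi, Set.mem_ofPred_eq, B]
      refine and_congr_right fun _ => ⟨fun hk k _ => ?_, fun hk k hks => ?_⟩
      · by_cases hks : k ∈ s
        · simpa [hks] using hk k hks
        · simp [hks]
      · have := hk k (Finset.mem_range.1 (hsub hks))
        rwa [if_pos (Finset.mem_coe.1 hks)] at this
    rw [e1, hl]
    refine lintegral_congr fun x => ?_
    rw [labelSequenceKernel_apply, Measure.infinitePi_pi _ fun k _ => ht' k,
      ← Finset.prod_subset hsub]
    · exact Finset.prod_congr rfl fun k hk => by simp [B, hk]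
    · intro k _ hk
      simp [B, hk]

end Labels

/-! ### Empirical label distributions -/

section Frequencies

variable {Y : Type*} [Fintype Y]

/-- The relative frequencies of the labels among the first `l` terms of a sequence; for `l = 0`,
the first term is used. -/
noncomputable def labelFreq (l : ℕ) (s : ℕ → Y) : stdSimplex ℝ Y :=
  ⟨fun y => ((max l 1 : ℕ) : ℝ)⁻¹ * ∑ k ∈ Finset.range (max l 1), Set.indicator {y} 1 (s k), by
    intro y
    have : ∀ k, (0 : ℝ) ≤ Set.indicator {y} 1 (s k) := fun k =>
      Set.indicator_nonneg (fun _ _ => zero_le_one) _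
    exact mul_nonneg (by positivity) (Finset.sum_nonneg fun k _ => this k), by
    classical
    have h0 : ((max l 1 : ℕ) : ℝ) ≠ 0 := by positivity
    rw [← Finset.mul_sum, Finset.sum_comm]
    simp only [Set.indicator_apply, Set.mem_singleton_iff, Pi.one_apply, Finset.sum_ite_eq,
      Finset.mem_univ, if_true, Finset.sum_const, Finset.card_range, nsmul_eq_mul, mul_one]
    exact inv_mul_cancel₀ h0⟩

theorem labelFreq_apply {l : ℕ} (hl : 0 < l) (s : ℕ → Y) (y : Y) :
    (labelFreq l s).1 y = (l : ℝ)⁻¹ * ∑ k ∈ Finset.range l, Set.indicator {y} 1 (s k) := by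
  simp [labelFreq, max_eq_left (Nat.succ_le_of_lt hl)]

theorem sum_labelFreq_mul {l : ℕ} (hl : 0 < l) (s : ℕ → Y) (a : Y → ℝ) :
    ∑ y, (labelFreq l s).1 y * a y = (l : ℝ)⁻¹ * ∑ k ∈ Finset.range l, a (s k) := by
  classical
  simp_rw [labelFreq_apply hl, mul_assoc, Finset.sum_mul]
  rw [← Finset.mul_sum, Finset.sum_comm]
  simp [Set.indicator_apply]

end Frequencies

/-! ### Convergence of the empirical label distributions. -/

section Empirical

variable {X : Type*} [MeasurableSpace X] {Y : Type*} [Fintype Y] [MeasurableSpace Y]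
  [MeasurableSingletonClass Y]

/-- The vector of the probabilities of the labels of `x`. -/
noncomputable def labelProb (PYX : Kernel X Y) [IsMarkovKernel PYX] (x : X) : stdSimplex ℝ Y :=
  ⟨fun y => (PYX x).real {y}, fun _ => measureReal_nonneg, by
    rw [sum_measureReal_singleton]
    simp⟩

theorem labelProb_apply (PYX : Kernel X Y) [IsMarkovKernel PYX] (x : X) (y : Y) :
    (labelProb PYX x).1 y = (PYX x).real {y} := rfl

theorem measurable_labelProb (PYX : Kernel X Y) [IsMarkovKernel PYX] :
    Measurable (labelProb PYX) :=
  (measurable_pi_lambda _ fun y =>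
    (Kernel.measurable_coe PYX (measurableSet_singleton y)).ennreal_toReal).subtype_mk

theorem measurable_labelFreq (l : ℕ) : Measurable (labelFreq l : (ℕ → Y) → stdSimplex ℝ Y) := by
  refine Measurable.subtype_mk (measurable_pi_lambda _ fun y => Measurable.const_mul ?_ _)
  exact Finset.measurable_sum _ fun k _ =>
    (measurable_one.indicator (measurableSet_singleton y)).comp (measurable_pi_apply k)

theorem ae_tendsto_labelFreq (PX : Measure X) [IsProbabilityMeasure PX] (PYX : Kernel X Y)
    [IsMarkovKernel PYX] :
    ∀ᵐ b ∂(PX ⊗ₘ labelSequenceKernel PYX),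
      Tendsto (fun l => labelFreq l b.2) atTop (𝓝 (labelProb PYX b.1)) := by
  rw [Measure.ae_compProd_iff]
  · refine Eventually.of_forall fun x => ?_
    rw [labelSequenceKernel_apply]
    have h1 : ∀ y : Y, ∀ᵐ s ∂(Measure.infinitePi fun _ : ℕ => PYX x),
        Tendsto (fun l : ℕ => (l : ℝ)⁻¹ • ∑ k ∈ Finset.range l,
          (Set.indicator {y} 1 (s k) : ℝ)) atTop
          (𝓝 (∫ y', (Set.indicator {y} 1 y' : ℝ) ∂(PYX x))) := by
      intro y
      refine ae_tendsto_average_comp (W := fun k (s : ℕ → Y) => s k) (C := 1)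
        (f := Set.indicator {y} 1) (fun k => measurable_pi_apply k)
        (iIndepFun_infinitePi (P := fun _ : ℕ => PYX x) (X := fun _ y => y)
          fun _ => measurable_id) (fun k => ?_) ?_ ?_
      · exact Measure.infinitePi_map_eval _ k
      · exact (measurable_one.indicator (measurableSet_singleton y)).stronglyMeasurable
      · intro y'
        by_cases h : y' ∈ ({y} : Set Y) <;> simp [h]
    filter_upwards [ae_all_iff.2 h1] with s hs
    rw [tendsto_subtype_rng, tendsto_pi_nhds]
    intro y
    have h2 := hs y
    rw [integral_indicator_one (measurableSet_singleton y)] at h2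
    refine h2.congr' ?_
    filter_upwards [eventually_gt_atTop 0] with l hl
    rw [labelFreq_apply hl, smul_eq_mul]
  · exact measurableSet_tendsto_fun (fun l => (measurable_labelFreq l).comp measurable_snd)
      ((measurable_labelProb PYX).comp measurable_fst)

/-- The blocks whose label frequencies deviate by at least `η` after step `L`. -/
def deviationSet (PYX : Kernel X Y) [IsMarkovKernel PYX] (L : ℕ) (η : ℝ) : Set (X × (ℕ → Y)) :=
  {b | ∃ l > L, η ≤ dist (labelFreq l b.2) (labelProb PYX b.1)}

theorem measurableSet_deviationSet (PYX : Kernel X Y) [IsMarkovKernel PYX] (L : ℕ) (η : ℝ) :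
    MeasurableSet (deviationSet PYX L η) := by
  have : deviationSet PYX L η
      = ⋃ l, ⋃ (_ : l > L), {b | η ≤ dist (labelFreq l b.2) (labelProb PYX b.1)} := by
    ext b
    simp [deviationSet]
  rw [this]
  refine MeasurableSet.iUnion fun l => MeasurableSet.iUnion fun _ => ?_
  exact measurableSet_le measurable_const (((measurable_labelFreq l).comp measurable_snd).dist
    ((measurable_labelProb PYX).comp measurable_fst))

/-- The sets decrease in L, and a block in all of them has non-converging frequencies, a null event;
continuity from above applies. -/
theorem tendsto_measureReal_deviationSet (PX : Measure X) [IsProbabilityMeasure PX]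
    (PYX : Kernel X Y) [IsMarkovKernel PYX] {η : ℝ} (hη : 0 < η) :
    Tendsto (fun L => (PX ⊗ₘ labelSequenceKernel PYX).real (deviationSet PYX L η)) atTop
      (𝓝 0) := by
  have h1 := tendsto_measure_iInter_atTop (μ := PX ⊗ₘ labelSequenceKernel PYX)
    (s := fun L => deviationSet PYX L η)
    (fun L => (measurableSet_deviationSet PYX L η).nullMeasurableSet)
    (fun L L' hL b ⟨l, hl, hb⟩ => ⟨l, lt_of_le_of_lt hL hl, hb⟩) ⟨0, measure_ne_top _ _⟩
  have h2 : (PX ⊗ₘ labelSequenceKernel PYX) (⋂ L, deviationSet PYX L η) = 0 := by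
    refine measure_mono_null ?_ (ae_iff.1 (ae_tendsto_labelFreq PX PYX))
    intro b hb hconv
    obtain ⟨L, hL⟩ := Metric.tendsto_atTop.1 hconv η hη
    obtain ⟨l, hl, hlb⟩ := Set.mem_iInter.1 hb L
    exact (hL l (le_of_lt hl)).not_ge hlb
  rw [h2] at h1
  have h3 := (ENNReal.tendsto_toReal ENNReal.zero_ne_top).comp h1
  simpa [Measure.real, Function.comp_def] using h3

/-- A continuous function of the empirical label distributions, averaged over the blocks,
converges to the expectation of the function of the conditional label distribution, jointly in the
number of blocks and the number of labels. -/
theorem IsSample.ae_average_labelFreq_near {d : ℕ} {PX : Measure X} [IsProbabilityMeasure PX]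
    {PYX : Kernel X Y} [IsMarkovKernel PYX] {PZ : Measure (Fin d → ℝ)}
    {Ω : Type*} [MeasurableSpace Ω] {μ : Measure Ω} [IsProbabilityMeasure μ]
    {xs : ℕ → Ω → X} {ys : ℕ → ℕ → Ω → Y} {zs : ℕ → Ω → Fin d → ℝ}
    (hS : IsSample PX PYX PZ μ xs ys zs)
    {E : Type*} [NormedAddCommGroup E] [NormedSpace ℝ E] [CompleteSpace E]
    {h : stdSimplex ℝ Y → E} (hh : Continuous h) :
    ∀ᵐ ω ∂μ, ∀ δ > 0, ∃ N L : ℕ, ∀ n l, N < n → L < l →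
      ‖(n : ℝ)⁻¹ • ∑ i ∈ Finset.range n, h (labelFreq l fun k => ys i k ω)
        - ∫ x, h (labelProb PYX x) ∂PX‖ < δ := by
  set ν := PX ⊗ₘ labelSequenceKernel PYX with hν
  have hfst : ν.map Prod.fst = PX := by
    have := Measure.fst_compProd PX (labelSequenceKernel PYX)
    exact this
  obtain ⟨C, hC⟩ : ∃ C, ∀ p, ‖h p‖ ≤ C := by
    obtain ⟨C, hC⟩ := (isCompact_range hh).isBounded.exists_norm_le
    exact ⟨C, fun p => hC _ ⟨p, rfl⟩⟩
  have hsm : StronglyMeasurable fun b : X × (ℕ → Y) => h (labelProb PYX b.1) :=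
    hh.stronglyMeasurable.comp_measurable ((measurable_labelProb PYX).comp measurable_fst)
  have hI : ∫ b, h (labelProb PYX b.1) ∂ν = ∫ x, h (labelProb PYX x) ∂PX := by
    conv_rhs => rw [← hfst]
    rw [integral_map measurable_fst.aemeasurable]
    exact (hh.stronglyMeasurable.comp_measurable (measurable_labelProb PYX)).aestronglyMeasurable
  have h1 := ae_tendsto_average_comp hS.measurable_block hS.indep_block hS.map_block hsm
    (fun b => hC _)
  -- The strong law gives the fraction of deviating blocks. Thresholds 1/(q+1) keep the family
  -- countable, so one null set serves all of them.
  have h2 : ∀ L q : ℕ, ∀ᵐ ω ∂μ, Tendsto (fun n : ℕ => (n : ℝ)⁻¹ • ∑ i ∈ Finset.range n,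
      (Set.indicator (deviationSet PYX L (1 / ((q : ℝ) + 1))) 1
        (xs i ω, fun k => ys i k ω) : ℝ)) atTop
      (𝓝 (ν.real (deviationSet PYX L (1 / ((q : ℝ) + 1))))) := by
    intro L q
    have hm := measurableSet_deviationSet PYX L (1 / ((q : ℝ) + 1))
    have := ae_tendsto_average_comp hS.measurable_block hS.indep_block hS.map_block (C := 1)
      (f := Set.indicator (deviationSet PYX L (1 / ((q : ℝ) + 1))) (1 : X × (ℕ → Y) → ℝ))
      (measurable_one.indicator hm).stronglyMeasurable
      (fun b => (norm_indicator_le_norm_self _ _).trans (by simp))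
    rwa [integral_indicator_one hm] at this
  filter_upwards [h1, ae_all_iff.2 fun L => ae_all_iff.2 (h2 L)] with ω hω1 hω2
  intro δ hδ
  rw [hI] at hω1
  have hC0 : 0 ≤ C := by
    have : Nonempty X := nonempty_of_isProbabilityMeasure PX
    exact (norm_nonneg _).trans (hC (labelProb PYX (Classical.arbitrary X)))
  obtain ⟨η, hη, hηh⟩ := Metric.uniformContinuous_iff.1
    (CompactSpace.uniformContinuous_of_continuous hh) (δ / 4) (by positivity)
  obtain ⟨q, hq⟩ := exists_nat_one_div_lt hη
  set η' : ℝ := 1 / ((q : ℝ) + 1) with hη'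
  have hη'pos : 0 < η' := by positivity
  set γ := δ / (4 * (2 * C + 1)) with hγ
  have hγpos : 0 < γ := by positivity
  obtain ⟨L, hL⟩ := ((tendsto_measureReal_deviationSet PX PYX hη'pos).eventually
    (gt_mem_nhds hγpos)).exists
  -- One deviation set covers every l > L, so N does not depend on l.
  obtain ⟨N, hN⟩ := eventually_atTop.1 (((hω2 L q).eventually (gt_mem_nhds hL)).and
    (Metric.tendsto_nhds.1 hω1 (δ / 4) (by positivity)))
  refine ⟨N, L, fun n l hn hl => ?_⟩
  obtain ⟨hN1, hN2⟩ := hN n hn.le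
  have hn0 : (0 : ℝ) < n := by exact_mod_cast (Nat.zero_le _).trans_lt hn
  set D := Set.indicator (deviationSet PYX L η') (1 : X × (ℕ → Y) → ℝ) with hD
  -- Uniform continuity of h handles the settled blocks; the others cost at most 2C each, and their
  -- fraction is below γ.
  have hterm : ∀ i, ‖h (labelFreq l fun k => ys i k ω) - h (labelProb PYX (xs i ω))‖
      ≤ δ / 4 + 2 * C * D (xs i ω, fun k => ys i k ω) := by
    intro i
    by_cases hb : (xs i ω, fun k => ys i k ω) ∈ deviationSet PYX L η'
    · rw [hD, Set.indicator_of_mem hb, Pi.one_apply]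
      have := norm_sub_le (h (labelFreq l fun k => ys i k ω)) (h (labelProb PYX (xs i ω)))
      linarith [hC (labelFreq l fun k => ys i k ω), hC (labelProb PYX (xs i ω))]
    · rw [hD, Set.indicator_of_notMem hb, mul_zero, add_zero, ← dist_eq_norm]
      refine (hηh ?_).le
      by_contra! hcon
      exact hb ⟨l, hl, hq.le.trans hcon⟩
  have hdiff : ‖(n : ℝ)⁻¹ • ∑ i ∈ Finset.range n, h (labelFreq l fun k => ys i k ω)
      - (n : ℝ)⁻¹ • ∑ i ∈ Finset.range n, h (labelProb PYX (xs i ω))‖ ≤ δ / 4 + δ / 4 := by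
    rw [← smul_sub, ← Finset.sum_sub_distrib, norm_smul, norm_inv, Real.norm_natCast]
    calc (n : ℝ)⁻¹ * _ ≤ (n : ℝ)⁻¹ * ∑ i ∈ Finset.range n,
          (δ / 4 + 2 * C * D (xs i ω, fun k => ys i k ω)) := by
          gcongr
          exact norm_sum_le_of_le _ fun i _ => hterm i
      _ = δ / 4 + 2 * C * ((n : ℝ)⁻¹ • ∑ i ∈ Finset.range n, D (xs i ω, fun k => ys i k ω)) := by
          rw [Finset.sum_add_distrib, ← Finset.mul_sum, Finset.sum_const, Finset.card_range,
            nsmul_eq_mul, smul_eq_mul]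
          field_simp
      _ ≤ δ / 4 + 2 * C * γ := by gcongr
      _ ≤ δ / 4 + δ / 4 := by
          have : 2 * C * γ ≤ (2 * C + 1) * γ := by nlinarith
          have e : (2 * C + 1) * γ = δ / 4 := by rw [hγ]; field_simp
          linarith
  rw [dist_eq_norm] at hN2
  calc _ ≤ _ + _ := norm_sub_le_norm_sub_add_norm_sub _
        ((n : ℝ)⁻¹ • ∑ i ∈ Finset.range n, h (labelProb PYX (xs i ω))) _
    _ ≤ (δ / 4 + δ / 4) + δ / 4 := by gcongr
    _ < δ := by linarith

end Empirical

/-! ### Continuity of networks in parameters and input -/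

section Continuity

theorem continuous_mlp {Y : Type*} {σ : ℝ → ℝ} (hσ : Continuous σ) (hidden : List ℕ) :
    ∀ a : ℕ, Continuous fun q : Params Y a hidden × (Fin a → ℝ) => mlp σ a hidden q.1 q.2 := by
  induction hidden with
  | nil =>
    intro a
    have h : Continuous fun q : (Matrix Y (Fin a) ℝ × (Y → ℝ)) × (Fin a → ℝ) =>
        q.1.1 *ᵥ q.2 + q.1.2 := by fun_prop
    exact h
  | cons b hidden ih =>
    intro a
    have h : Continuous fun q : ((Matrix (Fin b) (Fin a) ℝ × (Fin b → ℝ)) × Params Y b hidden) ×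
        (Fin a → ℝ) => (q.1.2, fun i => σ ((q.1.1.1 *ᵥ q.2 + q.1.1.2) i)) := by
      have h1 : Continuous fun q : ((Matrix (Fin b) (Fin a) ℝ × (Fin b → ℝ)) ×
          Params Y b hidden) × (Fin a → ℝ) => q.1.1.1 *ᵥ q.2 + q.1.1.2 := by fun_prop
      exact (continuous_snd.comp continuous_fst).prodMk
        (continuous_pi fun i => hσ.comp ((continuous_apply i).comp h1))
    exact (ih b).comp h

instance Params.locallyCompactSpace (Y : Type*) [Finite Y] (hidden : List ℕ) :
    ∀ a : ℕ, LocallyCompactSpace (Params Y a hidden) := by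
  induction hidden with
  | nil => exact fun a => inferInstanceAs (LocallyCompactSpace ((Y → Fin a → ℝ) × (Y → ℝ)))
  | cons b hidden ih =>
    intro a
    have := ih b
    exact inferInstanceAs
      (LocallyCompactSpace (((Fin b → Fin a → ℝ) × (Fin b → ℝ)) × Params Y b hidden))

variable {Y : Type*} [Fintype Y]

theorem sum_exp_pos (v : Y → ℝ) (y : Y) : 0 < ∑ y', Real.exp (v y') :=
  Finset.sum_pos (fun _ _ => Real.exp_pos _) ⟨y, Finset.mem_univ y⟩

theorem softmax_pos (v : Y → ℝ) (y : Y) : 0 < softmax v y :=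
  div_pos (Real.exp_pos _) (sum_exp_pos v y)

theorem sum_softmax [Nonempty Y] (v : Y → ℝ) : ∑ y, softmax v y = 1 := by
  simp only [softmax]
  rw [← Finset.sum_div, div_self (sum_exp_pos v (Classical.arbitrary Y)).ne']

theorem softmax_le_one (v : Y → ℝ) (y : Y) : softmax v y ≤ 1 :=
  (div_le_one (sum_exp_pos v y)).2
    (Finset.single_le_sum (f := fun y => Real.exp (v y)) (fun _ _ => (Real.exp_pos _).le)
      (Finset.mem_univ y))

theorem log_softmax (v : Y → ℝ) (y : Y) :
    Real.log (softmax v y) = v y - Real.log (∑ y', Real.exp (v y')) := by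
  rw [softmax, Real.log_div (Real.exp_pos _).ne' (sum_exp_pos v y).ne', Real.log_exp]

theorem continuous_log_net {σ : ℝ → ℝ} (hσ : Continuous σ) {d : ℕ} (hidden : List ℕ) (y : Y) :
    Continuous fun q : Params Y d hidden × (Fin d → ℝ) => Real.log (net σ q.1 q.2 y) := by
  have h := continuous_pi_iff.1 (continuous_mlp (Y := Y) hσ hidden d)
  simp only [net, log_softmax]
  refine (h y).sub (Continuous.log ?_ fun q => (sum_exp_pos _ y).ne')
  exact continuous_finsetSum _ fun y' _ => Real.continuous_exp.comp (h y')

theorem log_net_nonpos {σ : ℝ → ℝ} {d : ℕ} {hidden : List ℕ} (θ : Params Y d hidden)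
    (z : Fin d → ℝ) (y : Y) : Real.log (net σ θ z y) ≤ 0 :=
  Real.log_nonpos (softmax_pos _ _).le (softmax_le_one _ _)

end Continuity

/-! ### Uniform convergence of the Monte-Carlo loss -/

section FreeEnergy

variable {Y : Type*} [Fintype Y]

/-- The free energy `- log E_{P_Z} [exp (β ∑ y, p y * s Z y)]`. -/
noncomputable def freeEnergy {Z : Type*} [MeasurableSpace Z] (PZ : Measure Z) (β : ℝ)
    (s : Z → Y → ℝ) (p : Y → ℝ) : ℝ :=
  -Real.log (∫ z, Real.exp (β * ∑ y, p y * s z y) ∂PZ)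

theorem exp_mul_sum_le_one {β : ℝ} (hβ : 0 ≤ β) {s p : Y → ℝ} (hs : ∀ y, s y ≤ 0)
    (hp : ∀ y, 0 ≤ p y) : Real.exp (β * ∑ y, p y * s y) ≤ 1 :=
  Real.exp_le_one_iff.2 (mul_nonpos_of_nonneg_of_nonpos hβ
    (Finset.sum_nonpos fun y _ => mul_nonpos_of_nonneg_of_nonpos (hp y) (hs y)))

theorem abs_log_sub_log_le {a b c : ℝ} (hc : 0 < c) (ha : c ≤ a) (hb : c ≤ b) :
    |Real.log a - Real.log b| ≤ |a - b| / c := by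
  have key : ∀ {a b : ℝ}, c ≤ a → c ≤ b → Real.log a - Real.log b ≤ |a - b| / c := by
    intro a b ha hb
    have ha0 := hc.trans_le ha
    have hb0 := hc.trans_le hb
    rw [← Real.log_div ha0.ne' hb0.ne']
    calc Real.log (a / b) ≤ a / b - 1 := Real.log_le_sub_one_of_pos (div_pos ha0 hb0)
      _ = (a - b) / b := by field_simp
      _ ≤ |a - b| / b := by gcongr; exact le_abs_self _
      _ ≤ |a - b| / c := by gcongr
  refine abs_le.2 ⟨?_, key ha hb⟩
  have := key hb ha
  rw [abs_sub_comm] at this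
  linarith

variable {d : ℕ} {hidden : List ℕ}

/-- The integrand of the partition function, as a function of `z`, the label distribution and the
parameter. -/
noncomputable def gibbsWeight (β : ℝ) {σ : ℝ → ℝ} (hσ : Continuous σ)
    (Θ : Set (Params Y d hidden)) : C((Fin d → ℝ) × (stdSimplex ℝ Y × Θ), ℝ) where
  toFun q := Real.exp (β * ∑ y, q.2.1.1 y * Real.log (net σ q.2.2.1 q.1 y))
  continuous_toFun := by
    refine Real.continuous_exp.comp (continuous_const.mul
      (continuous_finsetSum _ fun y _ => Continuous.mul ?_ ?_))
    · exact (continuous_apply y).comp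
        (continuous_subtype_val.comp (continuous_fst.comp continuous_snd))
    · exact (continuous_log_net hσ hidden y).comp
        ((continuous_subtype_val.comp (continuous_snd.comp continuous_snd)).prodMk continuous_fst)

/-- Labels enter only through their frequencies, so the error of sampling z can be bounded uniformly
over a compact space, whatever the labels are. -/
theorem loss_eq_average (β : ℝ) {σ : ℝ → ℝ} (hσ : Continuous σ) {Θ : Set (Params Y d hidden)}
    {n m l : ℕ} (hl : 0 < l) (ys : ℕ → ℕ → Y) (zs : ℕ → Fin d → ℝ) (θ : Θ) :
    loss β σ n m l ys zs θ.1 = (n : ℝ)⁻¹ * ∑ i ∈ Finset.range n, -Real.log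
      ((m : ℝ)⁻¹ * ∑ j ∈ Finset.range m, gibbsWeight β hσ Θ (zs j, (labelFreq l (ys i), θ))) := by
  rw [loss, one_div, ← mul_neg, ← Finset.sum_neg_distrib]
  simp_rw [one_div]
  congr! 7 with i _ j _
  change _ = Real.exp _
  congr 1
  rw [sum_labelFreq_mul hl (ys i) fun y => Real.log (net σ θ.1 (zs j) y), kappa, one_div]
  ring

variable [MeasurableSpace Y] [MeasurableSingletonClass Y]

/-- Uniform law of large numbers: the Monte-Carlo loss converges almost surely to its expectation,
uniformly on compact sets of parameters. -/
theorem IsSample.ae_loss_near {X : Type*} [MeasurableSpace X] {PX : Measure X}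
    [IsProbabilityMeasure PX] {PYX : Kernel X Y} [IsMarkovKernel PYX] {PZ : Measure (Fin d → ℝ)}
    [IsProbabilityMeasure PZ] {Ω : Type*} [MeasurableSpace Ω] {μ : Measure Ω}
    [IsProbabilityMeasure μ] {xs : ℕ → Ω → X} {ys : ℕ → ℕ → Ω → Y} {zs : ℕ → Ω → Fin d → ℝ}
    (hS : IsSample PX PYX PZ μ xs ys zs) {β : ℝ} (hβ : 0 < β) {σ : ℝ → ℝ} (hσ : Continuous σ)
    {Θ : Set (Params Y d hidden)} (hΘ : IsCompact Θ) :
    ∀ᵐ ω ∂μ, ∀ δ > 0, ∃ N M L : ℕ, ∀ n m l : ℕ, N < n → M < m → L < l → ∀ θ ∈ Θ,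
      |loss β σ n m l (fun i k => ys i k ω) (fun j => zs j ω) θ
        - ∫ x, freeEnergy PZ β (fun z y => Real.log (net σ θ z y)) (labelProb PYX x).1 ∂PX|
        < δ := by
  have := isCompact_iff_compactSpace.1 hΘ
  set G := gibbsWeight β hσ Θ with hG
  have hGle : ∀ q, ‖G q‖ ≤ 1 := fun q => by
    change ‖Real.exp _‖ ≤ 1
    rw [Real.norm_of_nonneg (Real.exp_pos _).le]
    exact exp_mul_sum_le_one hβ.le (fun y => log_net_nonpos _ _ _) q.2.1.2.1
  -- `G.curry` is a bounded random element of C(simplex × Θ) with the sup norm; the strong law there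
  -- is a uniform law.
  have hbd : ∀ z, ‖G.curry z‖ ≤ 1 := fun z =>
    (ContinuousMap.norm_le _ zero_le_one).2 fun t => hGle (z, t)
  have hsm : StronglyMeasurable G.curry := G.curry.continuous.stronglyMeasurable
  have hint : Integrable G.curry PZ :=
    Integrable.of_bound hsm.aestronglyMeasurable 1 (Eventually.of_forall hbd)
  set φ := ∫ z, G.curry z ∂PZ with hφ
  have hφ_apply : ∀ t, φ t = ∫ z, G (z, t) ∂PZ := fun t =>
    ((ContinuousMap.evalCLM ℝ t).integral_comp_comm hint).symm
  have hφ_pos : ∀ t, 0 < φ t := fun t => by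
    rw [hφ_apply]
    exact integral_exp_pos ((ContinuousMap.evalCLM ℝ t).integrable_comp hint)
  obtain ⟨c, hc, hcφ⟩ : ∃ c > 0, ∀ t, c ≤ φ t := by
    cases isEmpty_or_nonempty (stdSimplex ℝ Y × Θ) with
    | inl h => exact ⟨1, one_pos, fun t => h.elim t⟩
    | inr h =>
      obtain ⟨t, -, ht⟩ := isCompact_univ.exists_isMinOn Set.univ_nonempty φ.continuous.continuousOn
      exact ⟨φ t, hφ_pos t, fun t' => ht (Set.mem_univ t')⟩
  let F : C(stdSimplex ℝ Y × Θ, ℝ) :=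
    ⟨fun t => -Real.log (φ t), (φ.continuous.log fun t => (hφ_pos t).ne').neg⟩
  have hF : ∀ p θ, F (p, θ) = freeEnergy PZ β (fun z y => Real.log (net σ θ.1 z y)) p.1 := by
    intro p θ
    change -Real.log (φ (p, θ)) = _
    rw [hφ_apply]
    rfl
  have hFint : Integrable (fun x => F.curry (labelProb PYX x)) PX := by
    obtain ⟨C, hC⟩ := (isCompact_range F.curry.continuous).isBounded.exists_norm_le
    exact Integrable.of_bound (F.curry.continuous.stronglyMeasurable.comp_measurable
      (measurable_labelProb PYX)).aestronglyMeasurable C (Eventually.of_forall fun x => hC _ ⟨_, rfl⟩)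
  filter_upwards [ae_tendsto_average_comp hS.measurable_zs hS.indep_zs hS.law_zs hsm hbd,
    hS.ae_average_labelFreq_near F.curry.continuous] with ω hω1 hω2
  change Tendsto _ _ (𝓝 φ) at hω1
  intro δ hδ
  obtain ⟨N, L, hNL⟩ := hω2 (δ / 2) (half_pos hδ)
  -- The first bound keeps the empirical partition functions above c/2, where log is Lipschitz with
  -- constant 2/c; the second then makes the error of the logarithm at most δ/2.
  obtain ⟨M, hM⟩ := eventually_atTop.1 (Metric.tendsto_nhds.1 hω1 (min (c / 2) (c / 2 * (δ / 2)))
    (by positivity))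
  refine ⟨N, M, L, fun n m l hn hm hl θ hθ => ?_⟩
  have hl0 : 0 < l := (Nat.zero_le _).trans_lt hl
  have hn0 : (0 : ℝ) < n := by exact_mod_cast (Nat.zero_le _).trans_lt hn
  have hlog : ∀ t, |-Real.log ((m : ℝ)⁻¹ * ∑ j ∈ Finset.range m, G (zs j ω, t)) - F t|
      ≤ δ / 2 := by
    intro t
    have h1 : |(m : ℝ)⁻¹ * ∑ j ∈ Finset.range m, G (zs j ω, t) - φ t|
        < min (c / 2) (c / 2 * (δ / 2)) := by
      refine lt_of_le_of_lt ?_ (hM m hm.le)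
      rw [dist_eq_norm]
      refine le_trans (le_of_eq ?_) (ContinuousMap.norm_coe_le_norm _ t)
      rw [Real.norm_eq_abs]
      congr 1
      simp
    have h2 := h1.trans_le (min_le_left _ _)
    have h3 := h1.trans_le (min_le_right _ _)
    have h4 : c / 2 ≤ (m : ℝ)⁻¹ * ∑ j ∈ Finset.range m, G (zs j ω, t) := by
      have := (abs_lt.1 h2).1
      linarith [hcφ t]
    change |-Real.log _ - -Real.log (φ t)| ≤ _
    rw [neg_sub_neg, abs_sub_comm]
    have h5 : c / 2 ≤ φ t := by linarith [hcφ t]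
    refine (abs_log_sub_log_le (half_pos hc) h4 h5).trans ?_
    rw [div_le_iff₀ (half_pos hc)]
    linarith
  have e1 : ∫ x, freeEnergy PZ β (fun z y => Real.log (net σ θ z y)) (labelProb PYX x).1 ∂PX
      = (∫ x, F.curry (labelProb PYX x) ∂PX) ⟨θ, hθ⟩ := by
    rw [← ContinuousMap.evalCLM_apply ℝ, ← ContinuousLinearMap.integral_comp_comm _ hFint]
    exact integral_congr_ae (Eventually.of_forall fun x => (hF _ ⟨θ, hθ⟩).symm)
  have h5 : |(n : ℝ)⁻¹ * ∑ i ∈ Finset.range n, F (labelFreq l fun k => ys i k ω, ⟨θ, hθ⟩)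
      - (∫ x, F.curry (labelProb PYX x) ∂PX) ⟨θ, hθ⟩| < δ / 2 := by
    refine lt_of_le_of_lt ?_ (hNL n l hn hl)
    refine le_trans (le_of_eq ?_) (ContinuousMap.norm_coe_le_norm _ ⟨θ, hθ⟩)
    rw [Real.norm_eq_abs]
    congr 1
    simp
  have h6 := loss_eq_average β hσ (n := n) (m := m) hl0 (fun i k => ys i k ω) (fun j => zs j ω)
    (⟨θ, hθ⟩ : Θ)
  rw [← hG] at h6
  rw [e1, h6]
  refine (abs_sub_le _ ((n : ℝ)⁻¹ * ∑ i ∈ Finset.range n,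
    F (labelFreq l fun k => ys i k ω, ⟨θ, hθ⟩)) _).trans_lt ?_
  have h7 : |(n : ℝ)⁻¹ * ∑ i ∈ Finset.range n, -Real.log ((m : ℝ)⁻¹ * ∑ j ∈ Finset.range m,
      G (zs j ω, (labelFreq l fun k => ys i k ω, ⟨θ, hθ⟩)))
      - (n : ℝ)⁻¹ * ∑ i ∈ Finset.range n, F (labelFreq l fun k => ys i k ω, ⟨θ, hθ⟩)|
      ≤ δ / 2 := by
    rw [← mul_sub, ← Finset.sum_sub_distrib, abs_mul, abs_of_pos (inv_pos.2 hn0),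
      inv_mul_le_iff₀ hn0]
    refine (Finset.abs_sum_le_sum_abs _ _).trans ((Finset.sum_le_sum fun i _ => hlog _).trans ?_)
    simp
  linarith

end FreeEnergy

/-! ### Bounds for free energies -/

section FreeEnergyBounds

variable {Y : Type*} [Fintype Y] {Z : Type*} [MeasurableSpace Z]

theorem integrable_gibbs {PZ : Measure Z} [IsFiniteMeasure PZ] {β : ℝ} (hβ : 0 ≤ β)
    {s : Z → Y → ℝ} (hs : ∀ y, Measurable fun z => s z y) (hs0 : ∀ z y, s z y ≤ 0) {p : Y → ℝ}
    (hp : ∀ y, 0 ≤ p y) : Integrable (fun z => Real.exp (β * ∑ y, p y * s z y)) PZ := by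
  refine Integrable.of_bound (C := 1) ?_ (Eventually.of_forall fun z => ?_)
  · exact (Real.measurable_exp.comp ((Finset.measurable_sum _ fun y _ =>
      (hs y).const_mul (p y)).const_mul β)).aestronglyMeasurable
  · rw [Real.norm_of_nonneg (Real.exp_pos _).le]
    exact exp_mul_sum_le_one hβ (hs0 z) hp

theorem freeEnergy_nonneg {PZ : Measure Z} [IsProbabilityMeasure PZ] {β : ℝ} (hβ : 0 ≤ β)
    {s : Z → Y → ℝ} (hs : ∀ y, Measurable fun z => s z y) (hs0 : ∀ z y, s z y ≤ 0) {p : Y → ℝ}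
    (hp : ∀ y, 0 ≤ p y) : 0 ≤ freeEnergy PZ β s p := by
  refine neg_nonneg.2 (Real.log_nonpos (integral_nonneg fun z => (Real.exp_pos _).le) ?_)
  have := integral_mono (integrable_gibbs (PZ := PZ) hβ hs hs0 hp) (integrable_const (1 : ℝ))
    fun z => exp_mul_sum_le_one hβ (hs0 z) hp
  simpa using this

/-- As s ≤ 0, the free energy increases with p; the all-ones vector dominates every probability
vector and supplies the constant bound needed for integrability. -/
theorem freeEnergy_le {PZ : Measure Z} [IsProbabilityMeasure PZ] {β : ℝ} (hβ : 0 ≤ β)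
    {s : Z → Y → ℝ} (hs : ∀ y, Measurable fun z => s z y) (hs0 : ∀ z y, s z y ≤ 0) {p : Y → ℝ}
    (hp : ∀ y, 0 ≤ p y) (hp1 : ∀ y, p y ≤ 1) :
    freeEnergy PZ β s p ≤ freeEnergy PZ β s 1 := by
  have h1 := integrable_gibbs (PZ := PZ) hβ hs hs0 (p := 1) fun _ => zero_le_one
  refine neg_le_neg (Real.log_le_log (integral_exp_pos h1)
    (integral_mono h1 (integrable_gibbs hβ hs hs0 hp) fun z => ?_))
  refine Real.exp_le_exp.2 (mul_le_mul_of_nonneg_left (Finset.sum_le_sum fun y _ => ?_) hβ)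
  exact mul_le_mul_of_nonpos_right (hp1 y) (hs0 z y)

theorem measurable_freeEnergy {PZ : Measure Z} [SFinite PZ] {β : ℝ} {s : Z → Y → ℝ}
    (hs : ∀ y, Measurable fun z => s z y) : Measurable (freeEnergy PZ β s) := by
  have h : Measurable fun q : (Y → ℝ) × Z => Real.exp (β * ∑ y, q.1 y * s q.2 y) := by
    refine Real.measurable_exp.comp ((Finset.measurable_sum _ fun y _ => ?_).const_mul β)
    exact ((measurable_pi_apply y).comp measurable_fst).mul ((hs y).comp measurable_snd)
  exact (Real.measurable_log.comp h.stronglyMeasurable.integral_prod_right'.measurable).neg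

theorem lintegral_ofReal_exp {PZ : Measure Z} [IsProbabilityMeasure PZ] {f : Z → ℝ}
    (hf : Integrable (fun z => Real.exp (f z)) PZ) :
    ENNReal.log (∫⁻ z, ENNReal.ofReal (Real.exp (f z)) ∂PZ)
      = (Real.log (∫ z, Real.exp (f z) ∂PZ) : EReal) := by
  rw [← ofReal_integral_eq_lintegral_ofReal hf (Eventually.of_forall fun z => (Real.exp_pos _).le),
    ENNReal.log_ofReal_of_pos (integral_exp_pos hf)]

end FreeEnergyBounds

/-! ### The objective in terms of free energies -/

section LogLikelihood

variable {Y : Type*} [Fintype Y] [MeasurableSpace Y] {Z : Type*} [MeasurableSpace Z]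

/-- The conditional distribution with the given log-likelihoods. -/
noncomputable def kernelOfLogLikelihood (s : Z → Y → ℝ) (hs : ∀ y, Measurable fun z => s z y) :
    Kernel Z Y where
  toFun z := ∑ y, ENNReal.ofReal (Real.exp (s z y)) • Measure.dirac y
  measurable' := by
    refine Measure.measurable_of_measurable_coe _ fun A _ => ?_
    simp only [Measure.coe_finsetSum, Finset.sum_apply, Measure.smul_apply, smul_eq_mul]
    exact Finset.measurable_sum _ fun y _ =>
      ((Real.measurable_exp.comp (hs y)).ennreal_ofReal).mul_const _

theorem isMarkovKernel_kernelOfLogLikelihood {s : Z → Y → ℝ}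
    (hs : ∀ y, Measurable fun z => s z y) (h1 : ∀ z, ∑ y, Real.exp (s z y) = 1) :
    IsMarkovKernel (kernelOfLogLikelihood s hs) := by
  refine ⟨fun z => ⟨?_⟩⟩
  change (∑ y, ENNReal.ofReal (Real.exp (s z y)) • Measure.dirac y : Measure Y) Set.univ = _
  simp only [Measure.coe_finsetSum, Finset.sum_apply, Measure.smul_apply, smul_eq_mul,
    measure_univ, mul_one]
  rw [← ENNReal.ofReal_sum_of_nonneg fun y _ => (Real.exp_pos _).le, h1, ENNReal.ofReal_one]

end LogLikelihood

section Objective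

variable {X : Type*} [MeasurableSpace X] {Y : Type*} [Fintype Y] [MeasurableSpace Y]
  [MeasurableSingletonClass Y] {Z : Type*} [MeasurableSpace Z]

theorem coe_ereal_sum {ι : Type*} (s : Finset ι) (f : ι → ℝ) :
    ((∑ i ∈ s, f i : ℝ) : EReal) = ∑ i ∈ s, (f i : EReal) := by
  classical
  induction s using Finset.induction_on with
  | empty => simp
  | insert a s ha ih => rw [Finset.sum_insert ha, Finset.sum_insert ha, EReal.coe_add, ih]

theorem coe_mul_sum_labelProb (PYX : Kernel X Y) [IsMarkovKernel PYX] (β : ℝ) (x : X) (t : Y → ℝ) :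
    ((β * ∑ y, (labelProb PYX x).1 y * t y : ℝ) : EReal)
      = (β : EReal) * ∑ y, ((PYX x {y} : ℝ≥0∞) : EReal) * (t y : EReal) := by
  rw [EReal.coe_mul, coe_ereal_sum]
  congr 1
  refine Finset.sum_congr rfl fun y _ => ?_
  rw [EReal.coe_mul, labelProb_apply, Measure.real, EReal.coe_ennreal_toReal (measure_ne_top _ _)]

theorem exponent_eq_coe (PYX : Kernel X Y) [IsMarkovKernel PYX] (β : ℝ) {r : Kernel Z Y} {x : X}
    {z : Z} {t : Y → ℝ} (h : ∀ y, r z {y} = ENNReal.ofReal (Real.exp (t y))) :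
    exponent PYX β r x z = ((β * ∑ y, (labelProb PYX x).1 y * t y : ℝ) : EReal) := by
  rw [coe_mul_sum_labelProb, exponent]
  congr 1
  refine Finset.sum_congr rfl fun y _ => ?_
  rw [h y, ENNReal.log_ofReal_of_pos (Real.exp_pos _), Real.log_exp]

theorem exponent_le_coe (PYX : Kernel X Y) [IsMarkovKernel PYX] {β : ℝ} (hβ : 0 ≤ β)
    {r : Kernel Z Y} {x : X} {z : Z} {t : Y → ℝ}
    (h : ∀ y, r z {y} ≤ ENNReal.ofReal (Real.exp (t y))) :
    exponent PYX β r x z ≤ ((β * ∑ y, (labelProb PYX x).1 y * t y : ℝ) : EReal) := by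
  rw [coe_mul_sum_labelProb, exponent]
  refine mul_le_mul_of_nonneg_left (Finset.sum_le_sum fun y _ => ?_) (by exact_mod_cast hβ)
  refine mul_le_mul_of_nonneg_left ?_ (EReal.coe_ennreal_nonneg _)
  have := ENNReal.log_le_log (h y)
  rwa [ENNReal.log_ofReal_of_pos (Real.exp_pos _), Real.log_exp] at this

theorem integrable_freeEnergy_labelProb {PX : Measure X} [IsFiniteMeasure PX] {PYX : Kernel X Y}
    [IsMarkovKernel PYX] {PZ : Measure Z} [IsProbabilityMeasure PZ] {β : ℝ} (hβ : 0 ≤ β)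
    {s : Z → Y → ℝ} (hs : ∀ y, Measurable fun z => s z y) (hs0 : ∀ z y, s z y ≤ 0) :
    Integrable (fun x => freeEnergy PZ β s (labelProb PYX x).1) PX := by
  refine Integrable.of_bound (C := freeEnergy PZ β s 1) ?_ (Eventually.of_forall fun x => ?_)
  · exact ((measurable_freeEnergy hs).comp
      (measurable_subtype_coe.comp (measurable_labelProb PYX))).aestronglyMeasurable
  · have hp := (labelProb PYX x).2
    rw [Real.norm_of_nonneg (freeEnergy_nonneg hβ hs hs0 hp.1)]
    exact freeEnergy_le hβ hs hs0 hp.1 fun y =>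
      (Finset.single_le_sum (f := (labelProb PYX x).1) (fun y _ => hp.1 y)
        (Finset.mem_univ y)).trans_eq hp.2

theorem objective_eq_lintegral (PX : Measure X) (PYX : Kernel X Y)
    [IsMarkovKernel PYX] (PZ : Measure Z) [IsProbabilityMeasure PZ] {β : ℝ} (hβ : 0 ≤ β)
    {r : Kernel Z Y} {s : Z → Y → ℝ} (hs : ∀ y, Measurable fun z => s z y)
    (hs0 : ∀ z y, s z y ≤ 0) (h : ∀ z y, r z {y} = ENNReal.ofReal (Real.exp (s z y))) :
    objective PX PYX PZ β r
      = ∫⁻ x, ENNReal.ofReal (freeEnergy PZ β s (labelProb PYX x).1) ∂PX := by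
  refine lintegral_congr fun x => ?_
  simp_rw [exponent_eq_coe PYX β (h _), EReal.exp_coe]
  rw [lintegral_ofReal_exp (integrable_gibbs hβ hs hs0 (labelProb PYX x).2.1), ← EReal.coe_neg,
    EReal.real_coe_toENNReal]
  rfl

theorem objective_eq_ofReal_integral (PX : Measure X) [IsFiniteMeasure PX] (PYX : Kernel X Y)
    [IsMarkovKernel PYX] (PZ : Measure Z) [IsProbabilityMeasure PZ] {β : ℝ} (hβ : 0 ≤ β)
    {r : Kernel Z Y} {s : Z → Y → ℝ} (hs : ∀ y, Measurable fun z => s z y)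
    (hs0 : ∀ z y, s z y ≤ 0) (h : ∀ z y, r z {y} = ENNReal.ofReal (Real.exp (s z y))) :
    objective PX PYX PZ β r
      = ENNReal.ofReal (∫ x, freeEnergy PZ β s (labelProb PYX x).1 ∂PX) := by
  rw [objective_eq_lintegral PX PYX PZ hβ hs hs0 h, ofReal_integral_eq_lintegral_ofReal
    (integrable_freeEnergy_labelProb hβ hs hs0)
    (Eventually.of_forall fun x => freeEnergy_nonneg hβ hs hs0 (labelProb PYX x).2.1)]

/-- Replacing a conditional distribution by a pointwise larger multiple `exp s` of it increases the
objective by at most a constant. -/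
theorem lintegral_freeEnergy_le_objective_add (PX : Measure X) [IsProbabilityMeasure PX]
    (PYX : Kernel X Y) [IsMarkovKernel PYX] (PZ : Measure Z) [IsProbabilityMeasure PZ] {β : ℝ}
    (hβ : 0 ≤ β) {r : Kernel Z Y} {s : Z → Y → ℝ} (hs : ∀ y, Measurable fun z => s z y)
    (hs0 : ∀ z y, s z y ≤ 0) {b : ℝ}
    (h : ∀ z y, r z {y} ≤ ENNReal.ofReal (Real.exp (s z y + b))) :
    ∫⁻ x, ENNReal.ofReal (freeEnergy PZ β s (labelProb PYX x).1) ∂PX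
      ≤ objective PX PYX PZ β r + ENNReal.ofReal (β * b) := by
  have e : ENNReal.ofReal (β * b) = ∫⁻ _, ENNReal.ofReal (β * b) ∂PX := by simp
  rw [e, objective, ← lintegral_add_right _ measurable_const]
  refine lintegral_mono fun x => ?_
  have hp := (labelProb PYX x).2
  have hint := integrable_gibbs (PZ := PZ) hβ hs hs0 hp.1
  -- Because p sums to 1, the shift by b is a factor exp(βb) that leaves the integral over z.
  have hexp : ∀ z, β * ∑ y, (labelProb PYX x).1 y * (s z y + b)
      = β * b + β * ∑ y, (labelProb PYX x).1 y * s z y := by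
    intro z
    simp_rw [mul_add]
    rw [Finset.sum_add_distrib, ← Finset.sum_mul, hp.2]
    ring
  have hint' : Integrable (fun z => Real.exp (β * ∑ y, (labelProb PYX x).1 y * (s z y + b))) PZ := by
    simp_rw [hexp, Real.exp_add]
    exact hint.const_mul _
  have h1 : ENNReal.log (∫⁻ z, EReal.exp (exponent PYX β r x z) ∂PZ)
      ≤ ((β * b - freeEnergy PZ β s (labelProb PYX x).1 : ℝ) : EReal) := by
    have h2 := lintegral_ofReal_exp hint'
    have h3 : Real.log (∫ z, Real.exp (β * ∑ y, (labelProb PYX x).1 y * (s z y + b)) ∂PZ)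
        = β * b - freeEnergy PZ β s (labelProb PYX x).1 := by
      simp_rw [hexp, Real.exp_add]
      rw [integral_const_mul, Real.log_mul (Real.exp_pos _).ne' (integral_exp_pos hint).ne',
        Real.log_exp, freeEnergy, sub_neg_eq_add]
    rw [h3] at h2
    rw [← h2]
    refine ENNReal.log_le_log (lintegral_mono fun z => ?_)
    rw [← EReal.exp_coe]
    exact EReal.exp_monotone (exponent_le_coe PYX hβ (h z))
  have h4 := EReal.toENNReal_le_toENNReal (EReal.neg_le_neg_iff.2 h1)
  rw [← EReal.coe_neg, EReal.real_coe_toENNReal, neg_sub] at h4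
  calc ENNReal.ofReal (freeEnergy PZ β s (labelProb PYX x).1)
      = ENNReal.ofReal (freeEnergy PZ β s (labelProb PYX x).1 - β * b + β * b) := by
        rw [sub_add_cancel]
    _ ≤ ENNReal.ofReal (freeEnergy PZ β s (labelProb PYX x).1 - β * b)
        + ENNReal.ofReal (β * b) := ENNReal.ofReal_add_le
    _ ≤ _ := by gcongr

theorem kernelOfLogLikelihood_singleton {s : Z → Y → ℝ} (hs : ∀ y, Measurable fun z => s z y)
    (z : Z) (y : Y) :
    kernelOfLogLikelihood s hs z {y} = ENNReal.ofReal (Real.exp (s z y)) := by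
  classical
  change (∑ y, ENNReal.ofReal (Real.exp (s z y)) • Measure.dirac y : Measure Y) {y} = _
  simp [Measure.coe_finsetSum, Set.indicator_apply]

theorem optimalValue_le_ofReal_integral (PX : Measure X) [IsFiniteMeasure PX] (PYX : Kernel X Y)
    [IsMarkovKernel PYX] (PZ : Measure Z) [IsProbabilityMeasure PZ] {β : ℝ} (hβ : 0 ≤ β)
    {s : Z → Y → ℝ} (hs : ∀ y, Measurable fun z => s z y) (hs0 : ∀ z y, s z y ≤ 0)
    (h1 : ∀ z, ∑ y, Real.exp (s z y) = 1) :
    optimalValue PX PYX PZ β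
      ≤ ENNReal.ofReal (∫ x, freeEnergy PZ β s (labelProb PYX x).1 ∂PX) := by
  rw [← objective_eq_ofReal_integral PX PYX PZ hβ hs hs0 (kernelOfLogLikelihood_singleton hs)]
  exact iInf₂_le (kernelOfLogLikelihood s hs) (isMarkovKernel_kernelOfLogLikelihood hs h1)

/-- The uniform conditional distribution has constant free energy β log |Y|. -/
theorem optimalValue_ne_top [Nonempty Y] (PX : Measure X) [IsFiniteMeasure PX] (PYX : Kernel X Y)
    [IsMarkovKernel PYX] (PZ : Measure Z) [IsProbabilityMeasure PZ] {β : ℝ} (hβ : 0 ≤ β) :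
    optimalValue PX PYX PZ β ≠ ⊤ := by
  have hY : (1 : ℝ) ≤ Fintype.card Y := by exact_mod_cast Fintype.card_pos
  refine ((optimalValue_le_ofReal_integral PX PYX PZ hβ
    (s := fun _ _ => -Real.log (Fintype.card Y)) (fun _ => measurable_const)
    (fun _ _ => neg_nonpos.2 (Real.log_nonneg hY)) fun _ => ?_).trans_lt
    ENNReal.ofReal_lt_top).ne
  rw [Real.exp_neg, Real.exp_log (by linarith)]
  simp

/-- Every conditional distribution is dominated, up to a factor close to `1`, by one whose
likelihoods are bounded away from zero. -/
theorem exists_bounded_logLikelihood [Nonempty Y] (r : Kernel Z Y) [IsMarkovKernel r] {b : ℝ}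
    (hb : 0 < b) :
    ∃ (s : Z → Y → ℝ) (C : ℝ), (∀ y, Measurable fun z => s z y) ∧ (∀ z y, s z y ≤ 0) ∧
      (∀ z y, -C ≤ s z y) ∧ (∀ z, ∑ y, Real.exp (s z y) = 1) ∧
      ∀ z y, r z {y} ≤ ENNReal.ofReal (Real.exp (s z y + b)) := by
  have hY : (0 : ℝ) < Fintype.card Y := by exact_mod_cast Fintype.card_pos
  set a := Real.exp (-b) with ha
  have ha0 : 0 < a := Real.exp_pos _
  have ha1 : 0 < 1 - a := by
    have : a < 1 := Real.exp_lt_one_iff.2 (neg_lt_zero.2 hb)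
    linarith
  -- A mixture with the uniform distribution: weight a = exp(-b) on r gives r ≤ exp(b) q, and the
  -- uniform part keeps q away from 0.
  set q : Z → Y → ℝ := fun z y => a * (r z).real {y} + (1 - a) * (Fintype.card Y : ℝ)⁻¹ with hq
  have hlow : ∀ z y, (1 - a) * (Fintype.card Y : ℝ)⁻¹ ≤ q z y := fun z y =>
    le_add_of_nonneg_left (mul_nonneg ha0.le measureReal_nonneg)
  have hpos : ∀ z y, 0 < q z y := fun z y => (by positivity : (0 : ℝ) < _).trans_le (hlow z y)
  have hsum : ∀ z, ∑ y, q z y = 1 := by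
    intro z
    have h1 : ∑ y, (r z).real {y} = 1 := by
      rw [sum_measureReal_singleton]
      simp
    simp only [hq]
    rw [Finset.sum_add_distrib, ← Finset.mul_sum, h1, Finset.sum_const, Finset.card_univ,
      nsmul_eq_mul]
    field_simp
    ring
  refine ⟨fun z y => Real.log (q z y), -Real.log ((1 - a) * (Fintype.card Y : ℝ)⁻¹),
    fun y => ?_, fun z y => ?_, fun z y => ?_, fun z => ?_, fun z y => ?_⟩
  · refine Real.measurable_log.comp (Measurable.add_const (Measurable.const_mul ?_ _) _)
    exact (Kernel.measurable_coe r (measurableSet_singleton y)).ennreal_toReal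
  · refine Real.log_nonpos (hpos z y).le ?_
    rw [← hsum z]
    exact Finset.single_le_sum (f := q z) (fun y _ => (hpos z y).le) (Finset.mem_univ y)
  · rw [neg_neg]
    exact Real.log_le_log (by positivity) (hlow z y)
  · simp_rw [Real.exp_log (hpos z _)]
    exact hsum z
  · rw [Real.exp_add, Real.exp_log (hpos z y), ← ofReal_measureReal (measure_ne_top _ _)]
    refine ENNReal.ofReal_le_ofReal ?_
    have e : a * Real.exp b = 1 := by rw [ha, ← Real.exp_add]; simp
    calc (r z).real {y} = a * (r z).real {y} * Real.exp b := by
          rw [mul_right_comm, e, one_mul]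
      _ ≤ q z y * Real.exp b := by
          gcongr
          exact le_add_of_nonneg_right (by positivity)

end Objective

/-! ### Approximation of conditional distributions by networks -/

section Approximation

variable {Y : Type*} [Fintype Y]

/-- One τ is lost in the logit and one in the normalizer, which is at most exp τ because exp s is
normalized. -/
theorem log_softmax_ge {s v : Y → ℝ} (h1 : ∑ y, Real.exp (s y) = 1) {τ : ℝ}
    (h : ∀ y, |s y - v y| ≤ τ) (y : Y) : s y - 2 * τ ≤ Real.log (softmax v y) := by
  have h2 : ∑ y', Real.exp (v y') ≤ Real.exp τ := by
    calc ∑ y', Real.exp (v y') ≤ ∑ y', Real.exp τ * Real.exp (s y') := by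
          refine Finset.sum_le_sum fun y' _ => ?_
          rw [← Real.exp_add]
          have := (abs_le.1 (h y')).1
          exact Real.exp_le_exp.2 (by linarith)
      _ = Real.exp τ := by rw [← Finset.mul_sum, h1, mul_one]
  have h3 := Real.log_le_log (sum_exp_pos v y) h2
  rw [Real.log_exp] at h3
  rw [log_softmax]
  have := (abs_le.1 (h y)).2
  linarith

/-- Bounded measurable functions are close to the outputs of a network off a set of small
measure. -/
theorem exists_mlp_near_in_measure {d : ℕ} (PZ : Measure (Fin d → ℝ)) [IsProbabilityMeasure PZ]
    {σ : ℝ → ℝ} (hσ : Continuous σ) (hσ' : ¬ ∃ a b : ℝ, ∀ t, σ t = a * t + b)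
    {s : (Fin d → ℝ) → Y → ℝ} (hs : ∀ y, Measurable fun z => s z y) {C : ℝ}
    (hC : ∀ z y, |s z y| ≤ C) {τ η : ℝ} (hτ : 0 < τ) (hη : 0 < η) :
    ∃ (hidden : List ℕ) (θ : Params Y d hidden) (bad : Set (Fin d → ℝ)), hidden ≠ [] ∧
      MeasurableSet bad ∧ PZ.real bad ≤ η ∧
      ∀ z ∉ bad, ∀ y, |s z y - mlp σ d hidden θ z y| ≤ τ := by
  -- With L¹ error α, Markov's inequality at level τ/2 bounds each label's bad set by η/2/(|Y| + 1),
  -- so their union has mass at most η/2. The complement of K takes the other half.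
  set α := η / 2 * (τ / 2) / (Fintype.card Y + 1) with hα
  have hαpos : 0 < α := by positivity
  have hint : ∀ y, Integrable (fun z => s z y) PZ := fun y =>
    Integrable.of_bound (hs y).aestronglyMeasurable C (Eventually.of_forall fun z => hC z y)
  have h1 := fun y => (hint y).exists_boundedContinuous_integral_sub_le hαpos
  choose u hu hu' using h1
  obtain ⟨K, -, hK, hKη⟩ := MeasurableSet.univ.exists_isCompact_sdiff_lt (μ := PZ)
    (measure_ne_top _ _) (ENNReal.ofReal_pos.2 (half_pos hη)).ne'
  obtain ⟨hidden, θ, hne, hθ⟩ := exists_mlp_near (Y := Y) hσ hσ' hK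
    (fun y => (u y).continuous) (half_pos hτ)
  refine ⟨hidden, θ, (Set.univ \ K) ∪ ⋃ y, {z | τ / 2 ≤ ‖s z y - u y z‖}, hne, ?_, ?_, ?_⟩
  · refine (MeasurableSet.univ.diff hK.measurableSet).union (MeasurableSet.iUnion fun y => ?_)
    exact measurableSet_le measurable_const ((hs y).sub (u y).continuous.measurable).norm
  · have h2 : ∀ y, PZ.real {z | τ / 2 ≤ ‖s z y - u y z‖} ≤ η / 2 / (Fintype.card Y + 1) := by
      intro y
      have h3 := (mul_meas_ge_le_integral_of_nonneg (Eventually.of_forall fun z => norm_nonneg _)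
        ((hint y).sub (hu' y)).norm (τ / 2)).trans (hu y)
      rw [← mul_le_mul_iff_right₀ (half_pos hτ)]
      refine h3.trans_eq ?_
      rw [hα]
      ring
    have h4 : PZ.real (Set.univ \ K) ≤ η / 2 :=
      ENNReal.toReal_le_of_le_ofReal (half_pos hη).le hKη.le
    calc _ ≤ PZ.real (Set.univ \ K) + PZ.real (⋃ y, {z | τ / 2 ≤ ‖s z y - u y z‖}) :=
          measureReal_union_le _ _
      _ ≤ η / 2 + ∑ y, PZ.real {z | τ / 2 ≤ ‖s z y - u y z‖} :=
          add_le_add h4 (measureReal_iUnion_fintype_le _)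
      _ ≤ η / 2 + ∑ _y : Y, η / 2 / (Fintype.card Y + 1) := by
          gcongr with y
          exact h2 y
      _ ≤ η / 2 + η / 2 := by
          gcongr
          rw [Finset.sum_const, Finset.card_univ, nsmul_eq_mul, mul_div_assoc',
            div_le_iff₀ (by positivity)]
          nlinarith
      _ = η := add_halves η
  · intro z hz y
    simp only [Set.mem_union, Set.mem_sdiff, Set.mem_univ, true_and, Set.mem_iUnion,
      Set.mem_ofPred_eq, not_or, not_not, not_exists, not_le, Real.norm_eq_abs] at hz
    have := hθ z hz.1 y
    have := hz.2 y
    have := abs_sub_le (s z y) (u y z) (mlp σ d hidden θ z y)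
    linarith

/-- Conditional distributions with likelihoods bounded away from zero have free energies nearly
attained by a network, uniformly in the label distribution. -/
theorem exists_net_freeEnergy_le {d : ℕ} (PZ : Measure (Fin d → ℝ)) [IsProbabilityMeasure PZ]
    {β : ℝ} (hβ : 0 < β) {σ : ℝ → ℝ} (hσ : Continuous σ)
    (hσ' : ¬ ∃ a b : ℝ, ∀ t, σ t = a * t + b) {s : (Fin d → ℝ) → Y → ℝ}
    (hs : ∀ y, Measurable fun z => s z y) (hs0 : ∀ z y, s z y ≤ 0) {C : ℝ}
    (hC : ∀ z y, -C ≤ s z y) (h1 : ∀ z, ∑ y, Real.exp (s z y) = 1) {ε : ℝ} (hε : 0 < ε) :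
    ∃ (hidden : List ℕ) (θ : Params Y d hidden), hidden ≠ [] ∧ ∀ p : stdSimplex ℝ Y,
      freeEnergy PZ β (fun z y => Real.log (net σ θ z y)) p.1 ≤ freeEnergy PZ β s p.1 + ε := by
  -- Off the bad set the exponent drops by at most 2βτ = ε/2, a factor a. Since c bounds the
  -- partition function A below for every p, bad mass at most (1 - a)c ≤ (1 - a)A costs another
  -- factor a, and a² = exp(-ε).
  set τ := ε / (4 * β) with hτ
  set c := Real.exp (-(β * C)) with hc
  set a := Real.exp (-(ε / 2)) with ha
  have ha1 : 0 < 1 - a := by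
    have : a < 1 := Real.exp_lt_one_iff.2 (by linarith)
    linarith
  obtain ⟨hidden, θ, bad, hne, hbad, hbadle, hgood⟩ := exists_mlp_near_in_measure PZ hσ hσ' hs
    (C := C) (fun z y => abs_le.2 ⟨hC z y, (hs0 z y).trans (by linarith [hC z y, hs0 z y])⟩)
    (τ := τ) (η := (1 - a) * c) (by positivity) (by positivity)
  refine ⟨hidden, θ, hne, fun p => ?_⟩
  have hp := p.2
  have hnet : ∀ y, Measurable fun z => Real.log (net σ θ z y) := fun y =>
    ((continuous_log_net hσ hidden y).comp (Continuous.prodMk_right θ)).measurable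
  have hi1 := integrable_gibbs (PZ := PZ) hβ.le hs hs0 hp.1
  have hi2 := integrable_gibbs (PZ := PZ) hβ.le hnet (fun z y => log_net_nonpos θ z y) hp.1
  set A := ∫ z, Real.exp (β * ∑ y, p.1 y * s z y) ∂PZ with hA
  have hAc : c ≤ A := by
    have := integral_mono (integrable_const c) hi1 fun z => by
      refine Real.exp_le_exp.2 ?_
      have h2 : ∑ y, p.1 y * -C ≤ ∑ y, p.1 y * s z y :=
        Finset.sum_le_sum fun y _ => mul_le_mul_of_nonneg_left (hC z y) (hp.1 y)
      rw [← Finset.sum_mul, hp.2, one_mul] at h2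
      calc -(β * C) = β * -C := by ring
        _ ≤ _ := mul_le_mul_of_nonneg_left h2 hβ.le
    simpa using this
  have hApos : 0 < A := (Real.exp_pos _).trans_le hAc
  have hkey : a * (A - PZ.real bad)
      ≤ ∫ z, Real.exp (β * ∑ y, p.1 y * Real.log (net σ θ z y)) ∂PZ := by
    have hib : Integrable (Set.indicator bad (1 : (Fin d → ℝ) → ℝ)) PZ :=
      (integrable_const (1 : ℝ)).indicator hbad
    rw [hA, ← integral_indicator_one hbad, ← integral_sub hi1 hib, ← integral_const_mul]
    refine integral_mono ((hi1.sub hib).const_mul a) hi2 fun z => ?_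
    dsimp only
    by_cases hz : z ∈ bad
    · rw [Set.indicator_of_mem hz, Pi.one_apply]
      refine le_trans (mul_nonpos_of_nonneg_of_nonpos (Real.exp_pos _).le ?_) (Real.exp_pos _).le
      linarith [exp_mul_sum_le_one hβ.le (hs0 z) hp.1]
    · rw [Set.indicator_of_notMem hz, sub_zero, ha, ← Real.exp_add]
      refine Real.exp_le_exp.2 ?_
      have h2 : ∑ y, p.1 y * (s z y - 2 * τ) ≤ ∑ y, p.1 y * Real.log (net σ θ z y) :=
        Finset.sum_le_sum fun y _ => mul_le_mul_of_nonneg_left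
          (log_softmax_ge (h1 z) (hgood z hz) y) (hp.1 y)
      simp_rw [mul_sub] at h2
      rw [Finset.sum_sub_distrib, ← Finset.sum_mul, hp.2, one_mul] at h2
      have h3 := mul_le_mul_of_nonneg_left h2 hβ.le
      have h4 : β * (2 * τ) = ε / 2 := by rw [hτ]; field_simp; norm_num
      linarith
  have h5 : a * (a * A) ≤ a * (A - PZ.real bad) := by
    refine mul_le_mul_of_nonneg_left ?_ (Real.exp_pos _).le
    nlinarith
  have h6 := Real.log_le_log (by positivity) (h5.trans hkey)
  rw [Real.log_mul (by positivity) (by positivity), Real.log_mul (by positivity) (by positivity),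
    ha, Real.log_exp] at h6
  simp only [freeEnergy]
  rw [← hA]
  linarith

variable [MeasurableSpace Y] [MeasurableSingletonClass Y]

theorem exists_net_integral_freeEnergy_le [Nonempty Y] {X : Type*} [MeasurableSpace X]
    (PX : Measure X) [IsProbabilityMeasure PX] (PYX : Kernel X Y) [IsMarkovKernel PYX] {d : ℕ}
    (PZ : Measure (Fin d → ℝ)) [IsProbabilityMeasure PZ] {β : ℝ} (hβ : 0 < β) {σ : ℝ → ℝ}
    (hσ : Continuous σ) (hσ' : ¬ ∃ a b : ℝ, ∀ t, σ t = a * t + b) {ε : ℝ} (hε : 0 < ε) :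
    ∃ (hidden : List ℕ) (θ : Params Y d hidden), hidden ≠ [] ∧
      ∫ x, freeEnergy PZ β (fun z y => Real.log (net σ θ z y)) (labelProb PYX x).1 ∂PX
        ≤ (optimalValue PX PYX PZ β).toReal + ε := by
  have hfin := optimalValue_ne_top PX PYX PZ hβ.le
  obtain ⟨r, hr, hrlt⟩ : ∃ r : Kernel (Fin d → ℝ) Y, ∃ _ : IsMarkovKernel r,
      objective PX PYX PZ β r < optimalValue PX PYX PZ β + ENNReal.ofReal (ε / 3) := by
    have h0 : optimalValue PX PYX PZ β < optimalValue PX PYX PZ β + ENNReal.ofReal (ε / 3) :=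
      ENNReal.lt_add_right hfin (ENNReal.ofReal_pos.2 (by positivity)).ne'
    simpa only [optimalValue, iInf_lt_iff] using h0
  -- This b makes the mixing cost βb equal to ε/3; near-optimality of r and the network
  -- approximation take the other thirds.
  obtain ⟨s, C, hs, hs0, hsC, hs1, hrs⟩ := exists_bounded_logLikelihood r
    (b := ε / (3 * β)) (by positivity)
  obtain ⟨hidden, θ, hne, hθ⟩ := exists_net_freeEnergy_le PZ hβ hσ hσ' hs hs0 hsC hs1
    (ε := ε / 3) (by positivity)
  refine ⟨hidden, θ, hne, ?_⟩
  have hnet : ∀ y, Measurable fun z => Real.log (net σ θ z y) := fun y =>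
    ((continuous_log_net hσ hidden y).comp (Continuous.prodMk_right θ)).measurable
  have hi1 := integrable_freeEnergy_labelProb (PX := PX) (PYX := PYX) (PZ := PZ) hβ.le hs hs0
  have hi2 := integrable_freeEnergy_labelProb (PX := PX) (PYX := PYX) (PZ := PZ) hβ.le hnet
    fun z y => log_net_nonpos θ z y
  have h1 : ∫ x, freeEnergy PZ β (fun z y => Real.log (net σ θ z y)) (labelProb PYX x).1 ∂PX
      ≤ ∫ x, freeEnergy PZ β s (labelProb PYX x).1 ∂PX + ε / 3 := by
    have := integral_mono hi2 (hi1.add (integrable_const (ε / 3))) fun x => hθ (labelProb PYX x)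
    rw [integral_add' hi1 (integrable_const _)] at this
    simpa using this
  have h2 := lintegral_freeEnergy_le_objective_add PX PYX PZ hβ.le hs hs0
    hrs
  rw [← ofReal_integral_eq_lintegral_ofReal hi1
    (Eventually.of_forall fun x => freeEnergy_nonneg hβ.le hs hs0 (labelProb PYX x).2.1)] at h2
  have h3 : β * (ε / (3 * β)) = ε / 3 := by field_simp
  rw [h3] at h2
  have h4 : ENNReal.ofReal (∫ x, freeEnergy PZ β s (labelProb PYX x).1 ∂PX)
      ≤ ENNReal.ofReal ((optimalValue PX PYX PZ β).toReal + ε / 3 + ε / 3) := by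
    rw [ENNReal.ofReal_add (by positivity) (by positivity),
      ENNReal.ofReal_add (by positivity) (by positivity), ENNReal.ofReal_toReal hfin]
    exact h2.trans (by gcongr)
  have h5 := (ENNReal.ofReal_le_ofReal_iff (by positivity)).1 h4
  linarith

end Approximation

end MAIB

theorem theorem2 {X : Type*} [MeasurableSpace X]
    {Y : Type*} [Fintype Y] [MeasurableSpace Y] [MeasurableSingletonClass Y] {d : ℕ}
    (PX : Measure X) [IsProbabilityMeasure PX]
    (PYX : Kernel X Y) [IsMarkovKernel PYX]
    (PZ : Measure (Fin d → ℝ)) [IsProbabilityMeasure PZ]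
    (β : ℝ) (hβ : 0 < β)
    (σ : ℝ → ℝ) (hσ : Continuous σ) (hσ' : ¬ ∃ a b : ℝ, ∀ t, σ t = a * t + b) :
    optimalValue PX PYX PZ β ≠ ⊤ ∧
    ∀ ε : ℝ, 0 < ε →
      ∃ (hidden : List ℕ) (Θ : Set (Params Y d hidden)),
        hidden ≠ [] ∧ Θ.Nonempty ∧ IsCompact Θ ∧
        ∀ (Ω : Type*) [MeasurableSpace Ω] (μ : Measure Ω) [IsProbabilityMeasure μ]
          (xs : ℕ → Ω → X) (ys : ℕ → ℕ → Ω → Y) (zs : ℕ → Ω → Fin d → ℝ),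
          IsSample PX PYX PZ μ xs ys zs →
          ∀ᵐ ω ∂μ, ∃ N M L : ℕ, ∀ n m l : ℕ, N < n → M < m → L < l →
            |(optimalValue PX PYX PZ β).toReal -
              estimator β σ Θ n m l (fun i k => ys i k ω) (fun j => zs j ω)| < ε := by
  have : Nonempty X := nonempty_of_isProbabilityMeasure PX
  have : Nonempty Y := nonempty_of_isProbabilityMeasure (PYX (Classical.arbitrary X))
  have hfin := optimalValue_ne_top PX PYX PZ hβ.le
  refine ⟨hfin, fun ε hε => ?_⟩
  obtain ⟨hidden, θ₀, hne, hθ₀⟩ := exists_net_integral_freeEnergy_le PX PYX PZ hβ hσ hσ'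
    (half_pos hε)
  -- The argument uses only that Θ is compact and contains θ₀.
  obtain ⟨Θ, hΘ, hΘ₀⟩ := exists_compact_mem_nhds θ₀
  refine ⟨hidden, Θ, hne, ⟨θ₀, mem_of_mem_nhds hΘ₀⟩, hΘ, ?_⟩
  intro Ω _ μ _ xs ys zs hS
  filter_upwards [hS.ae_loss_near hβ hσ hΘ] with ω hω
  obtain ⟨N, M, L, h⟩ := hω (ε / 4) (by positivity)
  refine ⟨N, M, L, fun n m l hn hm hl => ?_⟩
  -- Each softmax network is an admissible conditional distribution, so its expected loss is at
  -- least G. This also provides the lower boundedness that the real `sInf` needs in `csInf_le`.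
  have hlow : ∀ v ∈ loss β σ n m l (fun i k => ys i k ω) (fun j => zs j ω) '' Θ,
      (optimalValue PX PYX PZ β).toReal - ε / 4 ≤ v := by
    rintro _ ⟨θ, hθ, rfl⟩
    have hnet : ∀ y, Measurable fun z => Real.log (net σ θ z y) := fun y =>
      ((continuous_log_net hσ hidden y).comp (Continuous.prodMk_right θ)).measurable
    have h1 := optimalValue_le_ofReal_integral PX PYX PZ hβ.le hnet
      (fun z y => log_net_nonpos θ z y) fun z => by
        simp_rw [net, Real.exp_log (softmax_pos _ _)]
        exact sum_softmax _
    have h2 := ENNReal.toReal_le_of_le_ofReal (integral_nonneg fun x =>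
      freeEnergy_nonneg hβ.le hnet (fun z y => log_net_nonpos θ z y) (labelProb PYX x).2.1) h1
    have h3 := (abs_lt.1 (h n m l hn hm hl θ hθ)).1
    linarith
  have hinf : (optimalValue PX PYX PZ β).toReal - ε / 4
      ≤ estimator β σ Θ n m l (fun i k => ys i k ω) (fun j => zs j ω) :=
    le_csInf ⟨_, ⟨θ₀, mem_of_mem_nhds hΘ₀, rfl⟩⟩ hlow
  have hsup : estimator β σ Θ n m l (fun i k => ys i k ω) (fun j => zs j ω)
      ≤ loss β σ n m l (fun i k => ys i k ω) (fun j => zs j ω) θ₀ :=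
    csInf_le ⟨_, hlow⟩ ⟨θ₀, mem_of_mem_nhds hΘ₀, rfl⟩
  have h4 := (abs_lt.1 (h n m l hn hm hl θ₀ (mem_of_mem_nhds hΘ₀))).2
  rw [abs_lt]
  constructor <;> linarith
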